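/- Setting. Let $T\ge 0$ and $\mathbb{T}=[0,T]$. A control is a map $\omega:\{0\le s\le t\le T\}\to[0,\infty)$ with $\omega_{r,s}+\omega_{s,t}\le\omega_{r,t}$ for $r\le s\le t$ (hence $\omega_{s,s}=0$) and $\omega_{s,t}\to0$ as $t-s\to 0$. Let $V$ be a real Banach space. Let $\mathcal{W}=\bigoplus_{k\ge0}\mathcal{W}_k$ be a graded unital associative real normed algebra (for example a graded Banach algebra) with $\mathcal{W}_0=\mathbb{R}\cdot 1$, $\mathcal{W}_i\mathcal{W}_j\subset\mathcal{W}_{i+j}$, $|\alpha\beta|\le|\alpha||\beta|$, in which every $\alpha$ is the sum of its homogeneous components $\alpha^{(i)}\in\mathcal{W}_i$ and $|\alpha|=\sum_i|\alpha^{(i)}|$. Put $\mathcal{W}_{\le n}=\bigoplus_{k\le n}\mathcal{W}_k$, let $\alpha\triangleright\beta=\sum_{i+j\le n}\alpha^{(i)}\beta^{(j)}$ be the truncated product, and $\log_\triangleright(1+\alpha)=\sum_{k\ge1}\frac{(-1)^{k+1}}{k}\alpha^{\triangleright k}$ when $\alpha^{(0)}=0$. Hypotheses. Let $p\ge1$ and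 let $n\ge1$ be an integer with $n\ge\lfloor p\rfloor$. (1) $\mathcal{L}\subset\mathcal{W}$ is a linear subspace stable under $\alpha\mapsto\alpha^{(i)}$ for $0\le i\le n$; $\mathcal{L}_{\le n}=\mathcal{L}\cap\mathcal{W}_{\le n}$. (2) $\mathbf{x}=(\mathbf{x}_{s,t})_{0\le s\le t\le T}$ is a $\mathcal{W}$-valued $p$-rough path: $\mathbf{x}^{(0)}_{s,t}=1$, there are constants $\mu_i\ge 0$ with $|\mathbf{x}^{(i)}_{s,t}|\le\mu_i\,\omega_{s,t}^{i/p}$ for all $i\ge1$, and $\mathbf{x}_{r,s}\mathbf{x}_{s,t}=\mathbf{x}_{r,t}$ for $r\le s\le t$. Moreover $\boldsymbol\lambda_{s,t}:=\log_\triangleright\mathbf{x}_{s,t}\in\mathcal{L}_{\le n}$ for all $s\le t$. (3) $F$ is a Newtonian map: a linear map from $\mathcal{W}_{\le n+1}$ to $\mathcal{C}^0(V,V)$ such that $F[1]=\mathrm{id}$, $F[\alpha]$ is $\mathcal{C}^1$ for $\alpha\in\mathcal{W}_{\le n}$, $F[\alpha]$ is Lipschitz for $\alpha\in\mathcal{L}_{\le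 n}$, and $F[\alpha\beta]=\mathrm{D}F[\beta]\cdot F[\alpha]$ for $\alpha\in\mathcal{L}_{\le n}$, $\beta\in\mathcal{W}_{\le n}$ with $\alpha\beta\in\mathcal{W}_{\le n+1}$. (4) There are constants $\nu_1,\dots,\nu_n\ge0$ such that for $1\le i\le n$ and every $\alpha\in\mathcal{W}_i$, the function $F[\alpha]$ is bounded by $\nu_i|\alpha|$ and Lipschitz with constant $\nu_i|\alpha|$. Statement. For all $0\le s\le t\le T$ and $a\in V$ the ODE $z_u=a+\int_0^uF[\boldsymbol\lambda_{s,t}](z_v)\,\mathrm{d}v$, $u\ge0$, has a continuous solution, and the value at time $1$ is the same for all its solutions; denote this value by $\phi_{t,s}(a)$. Then $\phi$ is an almost flow, that is: - $\phi_{t,t}=\mathrm{id}$ for $t\in[0,T]$; - there is a non-decreasing continuous $\delta:\mathbb{R}_+\to\mathbb{R}_+$ with $\delta(0)=0$ such that for $0\le s\le t\le\tau\le T$, $\sup_a|\phi_{t,s}(a)-a|\le\delta(\tau)$ and $\phi_{t,s}$ is Lipschitz with constant $1+\delta(\tau)$; - for some $\theta>1$ and $M\ge0$, $\sup_a|\phi_{t,s}(\phi_{s,r}(a))-\phi_{t,r}(a)|\le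 M\,\omega_{r,t}^\theta$ for all $0\le r\le s\le t\le T$. If moreover $V$ is finite dimensional, then there is a constant $C\ge0$ such that for every $a\in V$ there exists a (not necessarily unique) D-solution starting from $a$, that is, a continuous path $y:[0,T]\to V$ with $y_0=a$ and $$|y_t-\phi_{t,s}(y_s)|\le C\,\omega_{s,t}^{(n+1)/p}\qquad\text{for all }0\le s\le t\le T.$$ -/

import Mathlib

/-- A grading `W = ⨁_{k ≥ 0} W_k` of a unital associative normed algebra, adapted to the norm:
every `α` is the sum of its homogeneous components `α⁽ⁱ⁾ ∈ W_i`, and `|α| = ∑ᵢ |α⁽ⁱ⁾|`.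
Both the algebraic direct sum and its `ℓ¹`-completion are covered. `piece k` is `W_k`, and
`comp k` is the (necessarily unique) projection `α ↦ α⁽ᵏ⁾` onto `W_k`. -/
structure NormGrading (W : Type*) [NormedRing W] [NormedAlgebra ℝ W] where
  /-- The homogeneous subspace `W_k`. -/
  piece : ℕ → Submodule ℝ W
  /-- The projection `α ↦ α⁽ᵏ⁾`. -/
  comp : ℕ → W →ₗ[ℝ] W
  comp_mem : ∀ i α, comp i α ∈ piece i
  comp_of_mem : ∀ i, ∀ α ∈ piece i, comp i α = α
  comp_of_mem_ne : ∀ i j, i ≠ j → ∀ α ∈ piece i, comp j α = 0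
  hasSum_comp : ∀ α, HasSum (fun i => comp i α) α
  hasSum_norm_comp : ∀ α, HasSum (fun i => ‖comp i α‖) ‖α‖
  piece_zero : piece 0 = Submodule.span ℝ {(1 : W)}
  mul_mem : ∀ i j, ∀ α ∈ piece i, ∀ β ∈ piece j, α * β ∈ piece (i + j)

namespace NormGrading

variable {W : Type*} [NormedRing W] [NormedAlgebra ℝ W] (G : NormGrading W)

/-- `W_{≤ n}`: the elements whose components of degree `> n` vanish. -/
def le (n : ℕ) : Submodule ℝ W where
  carrier := {α | ∀ i, n < i → G.comp i α = 0}
  add_mem' := by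
    intro α β hα hβ i hi
    rw [map_add, hα i hi, hβ i hi, add_zero]
  zero_mem' := by
    intro i _
    exact map_zero _
  smul_mem' := by
    intro c α hα i hi
    rw [map_smul, hα i hi, smul_zero]

/-- The truncated product `α ▷ β = ∑_{i + j ≤ n} α⁽ⁱ⁾ β⁽ʲ⁾`. -/
noncomputable def tmul (n : ℕ) (α β : W) : W :=
  ∑ i ∈ Finset.range (n + 1), ∑ j ∈ Finset.range (n + 1 - i), G.comp i α * G.comp j β

/-- Powers for the truncated product. -/
noncomputable def tpow (n : ℕ) (α : W) : ℕ → W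
  | 0 => 1
  | k + 1 => G.tmul n α (tpow n α k)

/-- The truncated logarithm `log_▷ (1 + α) = ∑_{k ≥ 1} (-1)^(k+1)/k α^{▷ k}`, for `α⁽⁰⁾ = 0`.
The terms with `k > n` vanish, see `NormGrading.tpow_eq_zero`. -/
noncomputable def tlog (n : ℕ) (x : W) : W :=
  ∑ k ∈ Finset.Icc 1 n, ((-1 : ℝ) ^ (k + 1) / (k : ℝ)) • G.tpow n (x - 1) k

theorem comp_tpow_eq_zero (n : ℕ) {α : W} (hα : G.comp 0 α = 0) (k j : ℕ) (hj : j < k) :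
    G.comp j (G.tpow n α k) = 0 := by
  induction k generalizing j with
  | zero => omega
  | succ k ih =>
    simp only [tpow, tmul, map_sum]
    refine Finset.sum_eq_zero fun i _ => Finset.sum_eq_zero fun l _ => ?_
    have hmem := G.mul_mem i l _ (G.comp_mem i α) _ (G.comp_mem l (G.tpow n α k))
    by_cases hij : i + l = j
    · by_cases h0 : i = 0
      · rw [h0, hα, zero_mul, map_zero]
      · rw [ih l (by omega), mul_zero, map_zero]
    · exact G.comp_of_mem_ne _ _ hij _ hmem

theorem tpow_eq_zero (n : ℕ) {α : W} (hα : G.comp 0 α = 0) (k : ℕ) (hk : n < k) :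
    G.tpow n α k = 0 := by
  obtain ⟨m, rfl⟩ : ∃ m, k = m + 1 := ⟨k - 1, by omega⟩
  simp only [tpow, tmul]
  refine Finset.sum_eq_zero fun i hi => Finset.sum_eq_zero fun l hl => ?_
  rw [Finset.mem_range] at hi hl
  by_cases h0 : i = 0
  · rw [h0, hα, zero_mul]
  · rw [G.comp_tpow_eq_zero n hα m l (by omega), mul_zero]

end NormGrading

/-- A control on `{0 ≤ s ≤ t ≤ T}`: non-negative, super-additive, and continuous close to the
diagonal (where it vanishes, by super-additivity). -/
structure IsControl (T : ℝ) (ω : ℝ → ℝ → ℝ) : Prop where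
  nonneg : ∀ s t, 0 ≤ s → s ≤ t → t ≤ T → 0 ≤ ω s t
  superadd : ∀ r s t, 0 ≤ r → r ≤ s → s ≤ t → t ≤ T → ω r s + ω s t ≤ ω r t
  small : ∀ ε > 0, ∃ η > 0, ∀ s t, 0 ≤ s → s ≤ t → t ≤ T → t - s < η → ω s t < ε

/-- A `W`-valued `p`-rough path `x s t`, `0 ≤ s ≤ t ≤ T`, controlled by `ω`. -/
structure IsRoughPath {W : Type*} [NormedRing W] [NormedAlgebra ℝ W] (G : NormGrading W)
    (T p : ℝ) (ω : ℝ → ℝ → ℝ) (x : ℝ → ℝ → W) : Prop where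
  comp_zero : ∀ s t, 0 ≤ s → s ≤ t → t ≤ T → G.comp 0 (x s t) = 1
  bound : ∃ μ : ℕ → ℝ, (∀ i, 0 ≤ μ i) ∧ ∀ i, 1 ≤ i → ∀ s t, 0 ≤ s → s ≤ t → t ≤ T →
    ‖G.comp i (x s t)‖ ≤ μ i * ω s t ^ ((i : ℝ) / p)
  mul : ∀ r s t, 0 ≤ r → r ≤ s → s ≤ t → t ≤ T → x r s * x s t = x r t

/-- A Newtonian map: a linear map `F` from `W_{≤ n+1}` to the continuous maps `V → V` with
`F[1] = id`, `F[α]` of class `C¹` for `α ∈ W_{≤ n}`, `F[α]` Lipschitz for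
`α ∈ L_{≤ n} = L ∩ W_{≤ n}`, and `F[α β] = D F[β] · F[α]` for `α ∈ L_{≤ n}`, `β ∈ W_{≤ n}`
whenever the left-hand side is defined, that is, `α β ∈ W_{≤ n+1}`.
For convenience `F` is given on all of `W` (a linear map on a subspace always extends), but its
values outside `W_{≤ n+1}` are not constrained. -/
structure IsNewtonianMap {W V : Type*} [NormedRing W] [NormedAlgebra ℝ W]
    [NormedAddCommGroup V] [NormedSpace ℝ V] (G : NormGrading W) (n : ℕ) (L : Submodule ℝ W)
    (F : W →ₗ[ℝ] (V → V)) : Prop where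
  continuous : ∀ α ∈ G.le (n + 1), Continuous (F α)
  map_one : F 1 = id
  contDiff : ∀ α ∈ G.le n, ContDiff ℝ 1 (F α)
  lipschitz : ∀ α ∈ L ⊓ G.le n, ∃ K, LipschitzWith K (F α)
  map_mul : ∀ α ∈ L ⊓ G.le n, ∀ β ∈ G.le n, α * β ∈ G.le (n + 1) →
    ∀ a, F (α * β) a = fderiv ℝ (F β) a (F α a)

/-- `z` solves `z_t = a + ∫₀ᵗ f(z_u) du` for `t ≥ 0`. -/
def IsODESolution {V : Type*} [NormedAddCommGroup V] [NormedSpace ℝ V]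
    (f : V → V) (a : V) (z : ℝ → V) : Prop :=
  ContinuousOn z (Set.Ici 0) ∧ ∀ t, 0 ≤ t → z t = a + ∫ u in (0 : ℝ)..t, f (z u)

open Classical in
/-- The time-one map `a ↦ z_1` of the ODE `z' = f(z)`, `z_0 = a` (with value `a` if there is no
solution; for Lipschitz `f` there is exactly one). -/
noncomputable def timeOneMap {V : Type*} [NormedAddCommGroup V] [NormedSpace ℝ V]
    (f : V → V) (a : V) : V :=
  if h : ∃ z, IsODESolution f a z then h.choose 1 else a

/-- The family `φ_{t,s}(a) = y_1[log_▷ x_{s,t}](a)`, where `y[α](a)` solves `y' = F[α](y)`,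
`y_0 = a`. The first time argument of `logFlow` is `t`, the second one is `s`. -/
noncomputable def logFlow {W V : Type*} [NormedRing W] [NormedAlgebra ℝ W]
    [NormedAddCommGroup V] [NormedSpace ℝ V] (G : NormGrading W) (n : ℕ)
    (F : W →ₗ[ℝ] (V → V)) (x : ℝ → ℝ → W) (t s : ℝ) : V → V :=
  timeOneMap (F (G.tlog n (x s t)))

/-- Almost flows on `[0, T]`. The function `δ` is evaluated at the time horizon `τ`, which may be
any time up to `T`. -/
structure IsAlmostFlow {V : Type*} [NormedAddCommGroup V]
    (T : ℝ) (ω : ℝ → ℝ → ℝ) (φ : ℝ → ℝ → V → V) : Prop where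
  diag : ∀ t, 0 ≤ t → t ≤ T → φ t t = id
  near_id : ∃ δ : ℝ → ℝ, Monotone δ ∧ Continuous δ ∧ δ 0 = 0 ∧
    ∀ τ s t, 0 ≤ s → s ≤ t → t ≤ τ → τ ≤ T →
      (∀ a, ‖φ t s a - a‖ ≤ δ τ) ∧ ∀ a b, ‖φ t s a - φ t s b‖ ≤ (1 + δ τ) * ‖a - b‖
  almost : ∃ θ > 1, ∃ M ≥ 0, ∀ r s t, 0 ≤ r → r ≤ s → s ≤ t → t ≤ T →
    ∀ a, ‖φ t s (φ s r a) - φ t r a‖ ≤ M * ω r t ^ (θ : ℝ)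

/-- `y` is a D-solution on `[0, T]` starting from `a`, with constant `C` and exponent `κ`. -/
structure IsDSolution {V : Type*} [NormedAddCommGroup V]
    (T : ℝ) (ω : ℝ → ℝ → ℝ) (φ : ℝ → ℝ → V → V) (κ C : ℝ) (a : V) (y : ℝ → V) : Prop where
  continuousOn : ContinuousOn y (Set.Icc 0 T)
  initial : y 0 = a
  bound : ∀ s t, 0 ≤ s → s ≤ t → t ≤ T → ‖y t - φ t s (y s)‖ ≤ C * ω s t ^ κ

/-! The flow of the logarithm is compared with the truncated Taylor scheme. Put h = ω_{s,t}^{1/p}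
and α = log_▷ x_{s,t}. The degree-i component of α is O(hⁱ) and the one of degree 0 vanishes, so
`F[α]` is O(h) both in sup norm and in Lipschitz constant. The ODE is therefore well posed, and
Grönwall's inequality gives the near-identity bounds on φ.

Along a solution of z' = F[α](z), the Newtonian relation gives d/du F[β](z_u) = F[α ▷ β](z_u) plus
terms of total degree > n. These involve only components of positive degree and are O(h^{n+1}).
Since α ▷ · raises the lowest degree, iterating stops after finitely many steps, and the series that
remains is exp_▷(α) ▷ β = x_{s,t} ▷ β. This is `IsNewtonianMap.norm_sub_tmul_le`: F[β](z_1) =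
F[x_{s,t} ▷ β](a) + O(h^{n+1}). The algebraic input, exp ∘ log = id in the truncated algebra, is a
congruence of real polynomials modulo X^{n+1}.

Taking β = 1 and then β equal to the truncation of x_{s,t}, and using Chen's relation, both φ_{t,s}
∘ φ_{s,r} and φ_{t,r} lie within O(ω_{r,t}^{(n+1)/p}) of `F` at the truncation of x_{r,t}. The
exponent exceeds 1 because n + 1 > p.

For D-solutions, Davie's lemma (`exists_scheme_bound`) controls the numerical schemes uniformly in
the partition. In finite dimension, compactness of closed balls gives a limit along an ultrafilter
of finite sets of times (`exists_isDSolution`). -/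

/-! ### Truncated exp ∘ log as a polynomial congruence -/

section LogPolynomial

open Polynomial

/-- The Taylor polynomial of `log (1 + X)` of degree `n`. -/
noncomputable def logPolynomial (n : ℕ) : ℝ[X] :=
  ∑ k ∈ Finset.Icc 1 n, C ((-1 : ℝ) ^ (k + 1) / (k : ℝ)) * X ^ k

/-- The Taylor polynomial of `exp` of degree `n`, composed with that of `log (1 + X)`. -/
noncomputable def expLogPolynomial (n : ℕ) : ℝ[X] :=
  ∑ k ∈ Finset.range (n + 1), C (1 / (k.factorial : ℝ)) * logPolynomial n ^ k

/-- The derivative is the partial geometric sum of 1/(1 + X), so multiplying by 1 + X telescopes. -/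
theorem one_add_X_mul_derivative_logPolynomial (n : ℕ) :
    (1 + X) * derivative (logPolynomial n) = 1 - (-X) ^ n := by
  induction n with
  | zero => simp [logPolynomial]
  | succ n ih =>
    have hc : C ((-1 : ℝ) ^ (n + 1 + 1) / ((n + 1 : ℕ) : ℝ)) * C ((n + 1 : ℕ) : ℝ) =
        (-1 : ℝ[X]) ^ n := by
      rw [← C_mul, div_mul_cancel₀ _ (by positivity)]
      simp [pow_succ]
    have hs : derivative (logPolynomial (n + 1)) = derivative (logPolynomial n) + (-X) ^ n := by
      rw [logPolynomial, Finset.sum_Icc_succ_top (by omega), ← logPolynomial, derivative_add,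
        derivative_C_mul_X_pow, Nat.add_sub_cancel, C_mul, hc, ← mul_pow, neg_one_mul]
    rw [hs, mul_add, ih, pow_succ]
    ring

theorem X_dvd_logPolynomial (n : ℕ) : X ∣ logPolynomial n := by
  refine Finset.dvd_sum fun k hk => Dvd.dvd.mul_left (dvd_pow_self _ ?_) _
  rw [Finset.mem_Icc] at hk
  omega

theorem derivative_expLogPolynomial (n : ℕ) :
    derivative (expLogPolynomial n) = derivative (logPolynomial n) *
      (expLogPolynomial n - C (1 / (n.factorial : ℝ)) * logPolynomial n ^ n) := by
  rw [expLogPolynomial, Finset.sum_range_succ, add_sub_cancel_right, ← Finset.sum_range_succ,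
    Finset.sum_range_succ', derivative_add, derivative_sum, Finset.mul_sum]
  simp only [pow_zero, mul_one, derivative_C, add_zero]
  refine Finset.sum_congr rfl fun k _ => ?_
  rw [derivative_C_mul, derivative_pow, Nat.add_sub_cancel]
  have hc : C (1 / ((k + 1).factorial : ℝ)) * C ((k + 1 : ℕ) : ℝ) =
      C (1 / (k.factorial : ℝ)) := by
    rw [← C_mul, Nat.factorial_succ]
    congr 1
    push_cast
    field_simp
  rw [← hc]
  ring

/-- Modulo X^n, the polynomial E = `expLogPolynomial n` satisfies (1 + X) E' = E, the equation of 1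
+ X itself; the recurrence compares coefficients of X^k. -/
theorem coeff_expLogPolynomial_succ {n k : ℕ} (hk : k < n) :
    (expLogPolynomial n).coeff (k + 1) * (k + 1) =
      (1 - k) * (expLogPolynomial n).coeff k := by
  have hdvd : X ^ n ∣ (1 + X) * derivative (expLogPolynomial n) - expLogPolynomial n := by
    rw [derivative_expLogPolynomial, ← mul_assoc, one_add_X_mul_derivative_logPolynomial]
    have h1 : X ^ n ∣ logPolynomial n ^ n := pow_dvd_pow_of_dvd (X_dvd_logPolynomial n) n
    have h2 : X ^ n ∣ (-X : ℝ[X]) ^ n := pow_dvd_pow_of_dvd (dvd_neg.2 dvd_rfl) n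
    have h3 : (1 - (-X) ^ n) * (expLogPolynomial n -
        C (1 / (n.factorial : ℝ)) * logPolynomial n ^ n) - expLogPolynomial n =
        -(C (1 / (n.factorial : ℝ)) * logPolynomial n ^ n) -
        (expLogPolynomial n - C (1 / (n.factorial : ℝ)) * logPolynomial n ^ n) * (-X) ^ n := by
      ring
    rw [h3]
    exact dvd_sub (dvd_neg.2 (h1.mul_left _)) (h2.mul_left _)
  have h0 := X_pow_dvd_iff.1 hdvd k hk
  rw [add_mul, one_mul, coeff_sub, coeff_add, coeff_derivative] at h0
  have hX : (X * derivative (expLogPolynomial n)).coeff k =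
      k * (expLogPolynomial n).coeff k := by
    cases k with
    | zero => simp
    | succ k =>
      rw [coeff_X_mul, coeff_derivative]
      push_cast
      ring
  rw [hX] at h0
  linarith

/-- The factor 1 - k of the recurrence vanishes at k = 1, which kills the coefficients of degree 2
to n. -/
theorem exists_expLogPolynomial_eq {n : ℕ} (hn : 0 < n) :
    ∃ q : ℝ[X], expLogPolynomial n = 1 + X + X ^ (n + 1) * q := by
  have h0 : (expLogPolynomial n).coeff 0 = 1 := by
    have hl : (logPolynomial n).coeff 0 = 0 := X_dvd_iff.1 (X_dvd_logPolynomial n)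
    rw [expLogPolynomial, finsetSum_coeff, Finset.sum_range_succ']
    simp [coeff_zero_eq_eval_zero] at hl ⊢
    simp [hl]
  have h1 : (expLogPolynomial n).coeff 1 = 1 := by
    have := coeff_expLogPolynomial_succ hn
    rw [h0] at this
    simpa using this
  have h2 : ∀ k, k + 2 ≤ n → (expLogPolynomial n).coeff (k + 2) = 0 := by
    intro k
    induction k with
    | zero =>
      intro hk
      have := coeff_expLogPolynomial_succ (n := n) (k := 1) (by omega)
      simpa using this
    | succ k ih =>
      intro hk
      have := coeff_expLogPolynomial_succ (n := n) (k := k + 2) (by omega)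
      rw [ih (by omega), mul_zero, mul_eq_zero] at this
      exact this.resolve_right (by positivity)
  have hdvd : X ^ (n + 1) ∣ expLogPolynomial n - (1 + X) := by
    rw [X_pow_dvd_iff]
    intro d hd
    match d, hd with
    | 0, _ => simp [h0]
    | 1, _ => simp [h1, coeff_one]
    | k + 2, hd => simp [h2 k (by omega), coeff_one, coeff_X]
  obtain ⟨q, hq⟩ := hdvd
  exact ⟨q, by rw [← hq]; ring⟩

end LogPolynomial

/-! ### Graded algebra: components, truncated products, exp and log -/

namespace NormGrading

variable {W : Type*} [NormedRing W] [NormedAlgebra ℝ W] (G : NormGrading W)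

theorem norm_comp_le (i : ℕ) (α : W) : ‖G.comp i α‖ ≤ ‖α‖ :=
  le_hasSum (G.hasSum_norm_comp α) i fun _ _ => norm_nonneg _

theorem continuous_comp (i : ℕ) : Continuous (G.comp i) :=
  ((G.comp i).mkContinuous 1 fun α => by simpa using G.norm_comp_le i α).continuous

theorem comp_comp (i j : ℕ) (α : W) : G.comp j (G.comp i α) = if i = j then G.comp i α else 0 := by
  split_ifs with h
  · subst h; exact G.comp_of_mem _ _ (G.comp_mem i α)
  · exact G.comp_of_mem_ne i j h _ (G.comp_mem i α)

theorem one_mem_piece_zero : (1 : W) ∈ G.piece 0 := by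
  rw [G.piece_zero]; exact Submodule.mem_span_singleton_self 1

theorem comp_zero_one : G.comp 0 (1 : W) = 1 := G.comp_of_mem 0 1 G.one_mem_piece_zero

theorem comp_one_of_ne {i : ℕ} (hi : i ≠ 0) : G.comp i (1 : W) = 0 :=
  G.comp_of_mem_ne 0 i hi.symm 1 G.one_mem_piece_zero

theorem comp_comp_mul_comp (i k j : ℕ) (α β : W) :
    G.comp j (G.comp i α * G.comp k β) = if i + k = j then G.comp i α * G.comp k β else 0 := by
  have h := G.mul_mem i k _ (G.comp_mem i α) _ (G.comp_mem k β)
  split_ifs with hij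
  · subst hij; exact G.comp_of_mem _ _ h
  · exact G.comp_of_mem_ne _ _ hij _ h

theorem comp_comp_mul (i j : ℕ) (α β : W) :
    G.comp j (G.comp i α * β) = if i ≤ j then G.comp i α * G.comp (j - i) β else 0 := by
  have h := ((G.hasSum_comp β).mul_left (G.comp i α)).map (G.comp j) (G.continuous_comp j)
  refine h.unique ?_
  have h' := hasSum_single (f := fun k => G.comp j (G.comp i α * G.comp k β)) (j - i)
    fun k hk => by rw [comp_comp_mul_comp, if_neg (by omega)]
  rw [comp_comp_mul_comp] at h'
  have hiff : i + (j - i) = j ↔ i ≤ j := by omega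
  simp only [hiff] at h'
  exact h'

/-- Elements may have infinitely many components, so the Cauchy product formula comes from passing
the continuous projection through the series of each factor. -/
theorem comp_mul (j : ℕ) (α β : W) :
    G.comp j (α * β) = ∑ i ∈ Finset.range (j + 1), G.comp i α * G.comp (j - i) β := by
  have h := ((G.hasSum_comp α).mul_right β).map (G.comp j) (G.continuous_comp j)
  refine h.unique ?_
  have h' : HasSum (fun i => G.comp j (G.comp i α * β))
      (∑ i ∈ Finset.range (j + 1), G.comp j (G.comp i α * β)) := hasSum_sum_of_ne_finset_zero fun i hi => by
      rw [comp_comp_mul, if_neg (by rw [Finset.mem_range] at hi; omega)]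
  rw [Finset.sum_congr rfl fun i hi => ?_]
  · exact h'
  rw [comp_comp_mul, if_pos (by rw [Finset.mem_range] at hi; omega)]

theorem comp_tmul {n j : ℕ} (hj : j ≤ n) (α β : W) :
    G.comp j (G.tmul n α β) = G.comp j (α * β) := by
  rw [comp_mul]
  simp only [tmul, map_sum, comp_comp_mul_comp]
  have hsub : Finset.range (j + 1) ⊆ Finset.range (n + 1) :=
    Finset.range_subset_range.2 (by omega)
  rw [← Finset.sum_subset hsub]
  · refine Finset.sum_congr rfl fun i hi => ?_
    rw [Finset.mem_range] at hi
    rw [Finset.sum_eq_single (j - i)]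
    · rw [if_pos (by omega)]
    · intro k _ hk
      rw [if_neg (by omega)]
    · intro h
      rw [Finset.mem_range] at h
      omega
  · intro i _ hi
    rw [Finset.mem_range] at hi
    exact Finset.sum_eq_zero fun k _ => if_neg (by omega)

theorem tmul_mem_le (n : ℕ) (α β : W) : G.tmul n α β ∈ G.le n := by
  intro j hj
  simp only [tmul, map_sum, comp_comp_mul_comp]
  refine Finset.sum_eq_zero fun i hi => Finset.sum_eq_zero fun k hk => if_neg ?_
  rw [Finset.mem_range] at hi hk
  omega

theorem comp_mem_le {n i : ℕ} (hi : i ≤ n) (α : W) : G.comp i α ∈ G.le n := fun j hj => by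
  rw [comp_comp, if_neg (by omega)]

theorem mem_le_of_mem_piece {n i : ℕ} (hi : i ≤ n) {α : W} (hα : α ∈ G.piece i) : α ∈ G.le n :=
  fun j hj => G.comp_of_mem_ne i j (by omega) α hα

theorem one_mem_le (n : ℕ) : (1 : W) ∈ G.le n :=
  G.mem_le_of_mem_piece (Nat.zero_le n) G.one_mem_piece_zero

theorem le_mono {m n : ℕ} (h : m ≤ n) : G.le (W := W) m ≤ G.le n :=
  fun _ hα i hi => hα i (h.trans_lt hi)

theorem eq_sum_comp {n : ℕ} {α : W} (hα : α ∈ G.le n) :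
    α = ∑ i ∈ Finset.range (n + 1), G.comp i α :=
  (G.hasSum_comp α).unique (hasSum_sum_of_ne_finset_zero fun i hi =>
    hα i (by rw [Finset.mem_range] at hi; omega))

theorem eq_of_comp_eq {n : ℕ} {α β : W} (hα : α ∈ G.le n) (hβ : β ∈ G.le n)
    (h : ∀ j ≤ n, G.comp j α = G.comp j β) : α = β := by
  rw [G.eq_sum_comp hα, G.eq_sum_comp hβ]
  exact Finset.sum_congr rfl fun i hi => h i (by rw [Finset.mem_range] at hi; omega)

/-- Agreement up to degree n is a ring congruence. Truncated products can thus be traded for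
ordinary ones, where associativity and polynomial evaluation are available. -/
theorem comp_mul_congr {n : ℕ} {α α' β β' : W} (hα : ∀ j ≤ n, G.comp j α = G.comp j α')
    (hβ : ∀ j ≤ n, G.comp j β = G.comp j β') :
    ∀ j ≤ n, G.comp j (α * β) = G.comp j (α' * β') := by
  intro j hj
  rw [comp_mul, comp_mul]
  refine Finset.sum_congr rfl fun i hi => ?_
  rw [Finset.mem_range] at hi
  rw [hα i (by omega), hβ (j - i) (by omega)]

theorem comp_tpow {n : ℕ} (α : W) (k : ℕ) : ∀ j ≤ n, G.comp j (G.tpow n α k) = G.comp j (α ^ k) := by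
  induction k with
  | zero => intro j _; rw [tpow, pow_zero]
  | succ k ih =>
    intro j hj
    rw [tpow, comp_tmul G hj, pow_succ']
    exact G.comp_mul_congr (fun _ _ => rfl) ih j hj

theorem comp_iterate_tmul {n : ℕ} (α β : W) (k : ℕ) :
    ∀ j ≤ n, G.comp j ((G.tmul n α)^[k] β) = G.comp j (α ^ k * β) := by
  induction k with
  | zero => intro j _; rw [Function.iterate_zero, id, pow_zero, one_mul]
  | succ k ih =>
    intro j hj
    rw [Function.iterate_succ_apply', comp_tmul G hj, pow_succ', mul_assoc]
    exact G.comp_mul_congr (fun _ _ => rfl) ih j hj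

theorem iterate_tmul_mem_le {n : ℕ} (α : W) {β : W} (hβ : β ∈ G.le n) (k : ℕ) :
    (G.tmul n α)^[k] β ∈ G.le n := by
  cases k with
  | zero => exact hβ
  | succ k => rw [Function.iterate_succ_apply']; exact G.tmul_mem_le n _ _

theorem comp_mul_eq_zero {a b : ℕ} {α β : W} (hα : ∀ j < a, G.comp j α = 0)
    (hβ : ∀ j < b, G.comp j β = 0) : ∀ j < a + b, G.comp j (α * β) = 0 := by
  intro j hj
  rw [comp_mul]
  refine Finset.sum_eq_zero fun i hi => ?_
  rw [Finset.mem_range] at hi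
  rcases lt_or_ge i a with h | h
  · rw [hα i h, zero_mul]
  · rw [hβ (j - i) (by omega), mul_zero]

theorem comp_pow_eq_zero {α : W} (hα : G.comp 0 α = 0) (k : ℕ) :
    ∀ j < k, G.comp j (α ^ k) = 0 := by
  induction k with
  | zero => intro j hj; omega
  | succ k ih =>
    rw [pow_succ]
    exact G.comp_mul_eq_zero ih (b := 1) (by intro j hj; rwa [Nat.lt_one_iff.1 hj])

theorem comp_tlog {n : ℕ} (x : W) :
    ∀ j ≤ n, G.comp j (G.tlog n x) = G.comp j (Polynomial.aeval (x - 1) (logPolynomial n)) := by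
  intro j hj
  simp only [tlog, logPolynomial, map_sum, map_smul, map_mul, Polynomial.aeval_C, map_pow,
    Polynomial.aeval_X, ← Algebra.smul_def, G.comp_tpow _ _ j hj]

/-- Evaluate the polynomial congruence at x - 1: the remainder contains (x - 1)^(n+1), which has no
component of degree ≤ n. -/
theorem comp_exp_tlog {n : ℕ} (hn : 0 < n) {x : W} (hx : G.comp 0 x = 1) :
    ∀ j ≤ n, G.comp j (∑ k ∈ Finset.range (n + 1),
      (1 / (k.factorial : ℝ)) • G.tlog n x ^ k) = G.comp j x := by
  intro j hj
  obtain ⟨q, hq⟩ := exists_expLogPolynomial_eq hn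
  have h0 : G.comp 0 (x - 1) = 0 := by rw [map_sub, hx, comp_zero_one, sub_self]
  have hpow : ∀ k, ∀ j ≤ n, G.comp j (G.tlog n x ^ k) =
      G.comp j (Polynomial.aeval (x - 1) (logPolynomial n) ^ k) := by
    intro k
    induction k with
    | zero => intro j _; rw [pow_zero, pow_zero]
    | succ k ih => rw [pow_succ, pow_succ]; exact G.comp_mul_congr ih (G.comp_tlog x)
  have heval := congrArg (Polynomial.aeval (x - 1)) hq
  simp only [expLogPolynomial, map_sum, map_add, map_mul, Polynomial.aeval_C, map_pow,
    Polynomial.aeval_X, ← Algebra.smul_def, map_one, add_sub_cancel] at heval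
  have h1 := congrArg (G.comp j) heval
  simp only [map_sum, map_add, map_smul] at h1 ⊢
  simp only [hpow _ j hj, h1]
  rw [G.comp_mul_eq_zero (b := 0) (G.comp_pow_eq_zero h0 (n + 1)) (fun _ h => by omega) j
    (by omega), add_zero]

/-- The left side is what the Taylor expansion along the flow produces at time 1; this identifies
it. -/
theorem sum_iterate_tmul_tlog {n : ℕ} (hn : 0 < n) {x : W} (hx : G.comp 0 x = 1) {β : W}
    (hβ : β ∈ G.le n) :
    ∑ k ∈ Finset.range (n + 1), (1 / (k.factorial : ℝ)) • (G.tmul n (G.tlog n x))^[k] β =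
      G.tmul n x β := by
  refine G.eq_of_comp_eq (Submodule.sum_mem _ fun k _ =>
    Submodule.smul_mem _ _ (G.iterate_tmul_mem_le _ hβ k)) (G.tmul_mem_le n _ _) fun j hj => ?_
  rw [comp_tmul G hj, ← G.comp_mul_congr (G.comp_exp_tlog hn hx) (fun _ _ => rfl) j hj,
    Finset.sum_mul]
  simp only [map_sum, map_smul, G.comp_iterate_tmul _ _ _ j hj, smul_mul_assoc]

/-! ### Bounds that scale with the degree -/

/-- `|α⁽ⁱ⁾| ≤ c hⁱ` for `i ≤ n`. -/
def GradedBound (n : ℕ) (h c : ℝ) (α : W) : Prop := ∀ i ≤ n, ‖G.comp i α‖ ≤ c * h ^ i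

variable {G}

theorem GradedBound.congr {n : ℕ} {h c : ℝ} {α β : W} (hα : G.GradedBound n h c α)
    (hαβ : ∀ j ≤ n, G.comp j β = G.comp j α) : G.GradedBound n h c β := fun i hi => by
  rw [hαβ i hi]; exact hα i hi

theorem GradedBound.mono {n : ℕ} {h h' c : ℝ} {α : W} (hα : G.GradedBound n h c α) (hc : 0 ≤ c)
    (hh : 0 ≤ h) (hh' : h ≤ h') : G.GradedBound n h' c α := fun i hi =>
  (hα i hi).trans (mul_le_mul_of_nonneg_left (pow_le_pow_left₀ hh hh' i) hc)

/-- Every term of the Cauchy product in degree j scales like h^j, and there are at most n + 1 of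
them. -/
theorem GradedBound.mul {n : ℕ} {h c d : ℝ} {α β : W} (hh : 0 ≤ h) (hc : 0 ≤ c) (hd : 0 ≤ d)
    (hα : G.GradedBound n h c α) (hβ : G.GradedBound n h d β) :
    G.GradedBound n h ((n + 1) * c * d) (α * β) := by
  intro j hj
  rw [comp_mul]
  have hterm : ∀ i ∈ Finset.range (j + 1),
      ‖G.comp i α * G.comp (j - i) β‖ ≤ c * d * h ^ j := by
    intro i hi
    rw [Finset.mem_range] at hi
    refine (norm_mul_le _ _).trans ((mul_le_mul (hα i (by omega)) (hβ (j - i) (by omega))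
      (norm_nonneg _) (by positivity)).trans (le_of_eq ?_))
    have : h ^ j = h ^ i * h ^ (j - i) := by rw [← pow_add]; congr 1; omega
    rw [this]; ring
  refine (norm_sum_le_of_le _ hterm).trans ?_
  rw [Finset.sum_const, Finset.card_range, nsmul_eq_mul]
  have : ((j + 1 : ℕ) : ℝ) ≤ n + 1 := by exact_mod_cast Nat.succ_le_succ hj
  calc _ ≤ ((n : ℝ) + 1) * (c * d * h ^ j) := mul_le_mul_of_nonneg_right this (by positivity)
    _ = _ := by ring

theorem gradedBound_one (n : ℕ) {h : ℝ} (hh : 0 ≤ h) : G.GradedBound n h ‖(1 : W)‖ 1 := by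
  intro i _
  rcases Nat.eq_zero_or_pos i with rfl | hi
  · rw [comp_zero_one, pow_zero, mul_one]
  · rw [G.comp_one_of_ne hi.ne', norm_zero]; positivity

theorem GradedBound.pow {n : ℕ} {h c : ℝ} {α : W} (hh : 0 ≤ h) (hc : 0 ≤ c)
    (hα : G.GradedBound n h c α) (k : ℕ) :
    G.GradedBound n h (((n + 1) * c) ^ k * ‖(1 : W)‖) (α ^ k) := by
  induction k with
  | zero => simpa using gradedBound_one n hh
  | succ k ih =>
    have := hα.mul hh hc (by positivity) ih
    rw [pow_succ' α]
    convert this using 1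
    ring

-- What matters is that the new constant does not depend on h: the logarithm is a polynomial in x -
-- 1, and products preserve the scaling.
variable (G) in
theorem exists_gradedBound_tlog (n : ℕ) {c : ℝ} (hc : 0 ≤ c) :
    ∃ c' ≥ 0, ∀ h ≥ 0, ∀ x : W, G.GradedBound n h c (x - 1) →
      G.GradedBound n h c' (G.tlog n x) := by
  refine ⟨∑ k ∈ Finset.Icc 1 n, ‖(-1 : ℝ) ^ (k + 1) / (k : ℝ)‖ *
    (((n + 1) * c) ^ k * ‖(1 : W)‖), by positivity, fun h hh x hx j hj => ?_⟩
  simp only [tlog, map_sum, map_smul, G.comp_tpow _ _ j hj, Finset.sum_mul]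
  refine norm_sum_le_of_le _ fun k _ => ?_
  rw [norm_smul, mul_assoc]
  exact mul_le_mul_of_nonneg_left (hx.pow hh hc k j hj) (norm_nonneg _)

theorem comp_zero_tlog {n : ℕ} {x : W} (hx : G.comp 0 x = 1) : G.comp 0 (G.tlog n x) = 0 := by
  have h0 : G.comp 0 (x - 1) = 0 := by rw [map_sub, hx, comp_zero_one, sub_self]
  rw [tlog, map_sum]
  refine Finset.sum_eq_zero fun k hk => ?_
  rw [Finset.mem_Icc] at hk
  rw [map_smul, G.comp_tpow_eq_zero n h0 k 0 (by omega), smul_zero]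

end NormGrading

/-! ### Autonomous ODEs with bounded Lipschitz fields -/

theorem IsODESolution.initial {V : Type*} [NormedAddCommGroup V] [NormedSpace ℝ V]
    {f : V → V} {a : V} {z : ℝ → V} (hz : IsODESolution f a z) : z 0 = a := by
  simpa using hz.2 0 le_rfl

theorem IsODESolution.norm_sub_le {V : Type*} [NormedAddCommGroup V] [NormedSpace ℝ V]
    {f : V → V} {B : ℝ} (hB : ∀ a, ‖f a‖ ≤ B) {a : V} {z : ℝ → V} (hz : IsODESolution f a z) {t : ℝ} (ht : 0 ≤ t) (ht1 : t ≤ 1) :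
    ‖z t - a‖ ≤ B := by
  have h := intervalIntegral.norm_integral_le_of_norm_le_const (a := (0 : ℝ)) (b := t)
    (f := fun u => f (z u)) (fun u _ => hB (z u))
  rw [hz.2 t ht, add_sub_cancel_left]
  refine h.trans ?_
  rw [sub_zero, abs_of_nonneg ht]
  exact mul_le_of_le_one_right ((norm_nonneg _).trans (hB a)) ht1

section ODE

variable {V : Type*} [NormedAddCommGroup V] [NormedSpace ℝ V] [CompleteSpace V]

theorem IsODESolution.hasDerivWithinAt {f : V → V} (hf : Continuous f) {a : V} {z : ℝ → V}
    (hz : IsODESolution f a z) {t : ℝ} (ht : 0 ≤ t) :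
    HasDerivWithinAt z (f (z t)) (Set.Ici 0) t := by
  -- A solution is unconstrained at negative times; freezing it there gives a continuous integrand
  -- on the whole line.
  have hc : Continuous fun u => f (z (max u 0)) :=
    hf.comp (hz.1.comp_continuous (by fun_prop) fun u => le_max_right u 0)
  have hd : HasDerivAt (fun t => a + ∫ u in (0 : ℝ)..t, f (z (max u 0))) (f (z t)) t := by
    have h := (hc.integral_hasStrictDerivAt 0 t).hasDerivAt.const_add a
    rwa [max_eq_left ht] at h
  have heq : ∀ s ∈ Set.Ici (0 : ℝ), z s = a + ∫ u in (0 : ℝ)..s, f (z (max u 0)) := by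
    intro s hs
    rw [hz.2 s hs]
    congr 1
    refine intervalIntegral.integral_congr fun u hu => ?_
    rw [Set.uIcc_of_le hs] at hu
    simp only [max_eq_left hu.1]
  exact hd.hasDerivWithinAt.congr heq (heq t ht)

theorem IsODESolution.hasDerivWithinAt_Ici {f : V → V} (hf : Continuous f) {a : V} {z : ℝ → V}
    (hz : IsODESolution f a z) {t : ℝ} (ht : 0 ≤ t) :
    HasDerivWithinAt z (f (z t)) (Set.Ici t) t :=
  (hz.hasDerivWithinAt hf ht).mono (Set.Ici_subset_Ici.2 ht)

theorem isODESolution_of_hasDerivWithinAt {f : V → V} (hf : Continuous f) {a : V} {z : ℝ → V}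
    (h0 : z 0 = a) (hz : ∀ t, 0 ≤ t → HasDerivWithinAt z (f (z t)) (Set.Ici 0) t) :
    IsODESolution f a z := by
  have hc : ContinuousOn z (Set.Ici 0) := fun t ht => (hz t ht).continuousWithinAt
  refine ⟨hc, fun t ht => ?_⟩
  have hsub : Set.Icc 0 t ⊆ Set.Ici (0 : ℝ) := Set.Icc_subset_Ici_self
  have h := intervalIntegral.integral_eq_sub_of_hasDeriv_right_of_le ht (hc.mono hsub)
    (fun u hu => (hz u hu.1.le).mono (Set.Ioi_subset_Ici hu.1.le))
    ((hf.comp_continuousOn (hc.mono hsub)).intervalIntegrable_of_Icc ht)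
  have h' : ∫ u in (0 : ℝ)..t, f (z u) = z t - z 0 := h
  rw [h', h0]
  abel

theorem IsODESolution.dist_le {f : V → V} {K : NNReal} (hf : LipschitzWith K f) {a b : V}
    {y z : ℝ → V} (hy : IsODESolution f a y) (hz : IsODESolution f b z) {t : ℝ} (ht : 0 ≤ t) :
    dist (y t) (z t) ≤ dist a b * Real.exp (K * t) := by
  have h := dist_le_of_trajectories_ODE (v := fun _ => f) (fun _ => hf)
    (hy.1.mono (fun u (hu : u ∈ Set.Icc 0 t) => hu.1))
    (fun u hu => hy.hasDerivWithinAt_Ici hf.continuous hu.1)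
    (hz.1.mono (fun u (hu : u ∈ Set.Icc 0 t) => hu.1))
    (fun u hu => hz.hasDerivWithinAt_Ici hf.continuous hu.1)
    (le_of_eq (by rw [hy.initial, hz.initial])) t ⟨ht, le_rfl⟩
  simpa using h

theorem exists_hasDerivWithinAt_Icc {f : V → V} {K : NNReal} (hf : LipschitzWith K f) {B : ℝ}
    (hB : ∀ a, ‖f a‖ ≤ B) (a : V) {N : ℝ} (hN : 0 ≤ N) :
    ∃ z : ℝ → V, z 0 = a ∧
      ∀ t ∈ Set.Icc 0 N, HasDerivWithinAt z (f (z t)) (Set.Icc 0 N) t := by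
  have hB0 : 0 ≤ B := (norm_nonneg _).trans (hB a)
  -- As f is globally bounded by B, a ball of radius B * N lets Picard–Lindelöf cover all of [0, N]
  -- at once.
  have hP : IsPicardLindelof (fun _ => f) (⟨0, le_rfl, hN⟩ : Set.Icc 0 N) a
      ⟨B * N, mul_nonneg hB0 hN⟩ 0 ⟨B, hB0⟩ K :=
    { lipschitzOnWith := fun _ _ => hf.lipschitzOnWith
      continuousOn := fun _ _ => continuousOn_const
      norm_le := fun _ _ x _ => hB x
      mul_max_le := by
        change B * max (N - 0) (0 - 0) ≤ B * N - 0
        rw [sub_zero, sub_zero, sub_zero, max_eq_left hN] }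
  exact hP.exists_eq_forall_mem_Icc_hasDerivWithinAt₀

theorem exists_isODESolution {f : V → V} {K : NNReal} (hf : LipschitzWith K f) {B : ℝ}
    (hB : ∀ a, ‖f a‖ ≤ B) (a : V) : ∃ z, IsODESolution f a z := by
  choose z hz0 hz using fun N : ℕ => exists_hasDerivWithinAt_Icc hf hB a (N.cast_nonneg (α := ℝ))
  have hagree : ∀ M N : ℕ, ∀ t : ℝ, 0 ≤ t → t ≤ M → t ≤ N → z M t = z N t := by
    intro M N t ht hM hN
    have key : ∀ M : ℕ, t ≤ M → ContinuousOn (z M) (Set.Icc 0 t) ∧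
        ∀ u ∈ Set.Ico 0 t, HasDerivWithinAt (z M) (f (z M u)) (Set.Ici u) u := by
      intro M hM
      refine ⟨fun u hu => ((hz M u ⟨hu.1, hu.2.trans hM⟩).mono
        (Set.Icc_subset_Icc_right hM)).continuousWithinAt, fun u hu => ?_⟩
      have hlt : u < M := hu.2.trans_le hM
      exact ((hz M u ⟨hu.1, hlt.le⟩).mono (Set.Icc_subset_Icc_left hu.1)).mono_of_mem_nhdsWithin
        (Icc_mem_nhdsGE hlt)
    exact ODE_solution_unique (v := fun _ => f) (fun _ => hf) (key M hM).1 (key M hM).2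
      (key N hN).1 (key N hN).2 (by rw [hz0, hz0]) ⟨ht, le_rfl⟩
  -- The `+ 1` puts t strictly before the end of its interval, so a single local solution represents
  -- the glued path around t.
  refine ⟨fun t => z (⌈t⌉₊ + 1) t, isODESolution_of_hasDerivWithinAt hf.continuous (hz0 _) ?_⟩
  intro t ht
  have hlt : t < (⌈t⌉₊ + 1 : ℕ) := by push_cast; linarith [Nat.le_ceil t]
  have h := (hz (⌈t⌉₊ + 1) t ⟨ht, hlt.le⟩)
  have hnhds : Set.Icc 0 ((⌈t⌉₊ + 1 : ℕ) : ℝ) ∈ nhdsWithin t (Set.Ici 0) := by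
    rw [← Set.Ici_inter_Iic]
    exact Filter.inter_mem self_mem_nhdsWithin (mem_nhdsWithin_of_mem_nhds (Iic_mem_nhds hlt))
  refine (h.mono_of_mem_nhdsWithin hnhds).congr_of_eventuallyEq ?_ rfl
  filter_upwards [hnhds] with u hu
  exact hagree _ _ u hu.1 (by push_cast; linarith [Nat.le_ceil u]) hu.2

theorem timeOneMap_eq {f : V → V} {K : NNReal} (hf : LipschitzWith K f) {a : V} {z : ℝ → V}
    (hz : IsODESolution f a z) : timeOneMap f a = z 1 := by
  have h : ∃ z, IsODESolution f a z := ⟨z, hz⟩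
  rw [timeOneMap, dif_pos h]
  have := h.choose_spec.dist_le hf hz zero_le_one
  rw [dist_self, zero_mul] at this
  exact dist_le_zero.1 this

end ODE

/-! ### Continuous majorants and elementary properties of controls -/

/-- A control need not be continuous away from the diagonal, so δ cannot be read off from ω. The
majorant is a uniformly convergent sum of ramps, the k-th of height A/2^k and saturated from η (k +
1) on. -/
theorem exists_continuous_monotone_ge {g : ℝ → ℝ} {B : ℝ} (hB : ∀ τ, 0 ≤ τ → g τ ≤ B)
    (hg0 : g 0 ≤ 0)
    (hg : ∀ ε > 0, ∃ η > 0, ∀ τ, 0 ≤ τ → τ < η → g τ ≤ ε) :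
    ∃ δ : ℝ → ℝ, Monotone δ ∧ Continuous δ ∧ δ 0 = 0 ∧ ∀ τ, 0 ≤ τ → g τ ≤ δ τ := by
  set A : ℝ := max B 1 with hA
  have hA0 : 0 < A := lt_of_lt_of_le one_pos (le_max_right _ _)
  choose η hη0 hη using fun k : ℕ => hg (A * (1 / 2) ^ k) (by positivity)
  have hs : Summable fun k : ℕ => A * (1 / 2 : ℝ) ^ k :=
    (summable_geometric_of_lt_one (by norm_num) (by norm_num)).mul_left A
  set f : ℕ → ℝ → ℝ := fun k τ => A * (1 / 2) ^ k * min 1 (max 0 τ / η (k + 1)) with hf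
  have hf0 : ∀ k τ, 0 ≤ f k τ := fun k τ => by
    have := (hη0 (k + 1)).le
    have : 0 ≤ min 1 (max 0 τ / η (k + 1)) := le_min zero_le_one (by positivity)
    simp only [hf]; positivity
  have hfle : ∀ k τ, f k τ ≤ A * (1 / 2) ^ k := fun k τ =>
    mul_le_of_le_one_right (by positivity) (min_le_left _ _)
  have hfs : ∀ τ, Summable fun k => f k τ := fun τ =>
    Summable.of_nonneg_of_le (hf0 · τ) (hfle · τ) hs
  refine ⟨fun τ => ∑' k, f k τ, fun σ τ h => ?_, ?_, ?_, fun τ hτ => ?_⟩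
  · refine (hfs σ).tsum_le_tsum (fun k => ?_) (hfs τ)
    have := (hη0 (k + 1)).le
    simp only [hf]
    gcongr
  · refine continuous_tsum (fun k => ?_) hs fun k τ => ?_
    · simp only [hf]; fun_prop
    · rw [Real.norm_of_nonneg (hf0 k τ)]; exact hfle k τ
  · simp [hf]
  · rcases hτ.eq_or_lt with rfl | hτ
    · exact hg0.trans (tsum_nonneg (hf0 · 0))
    -- Either one saturated ramp already dominates g τ, or the bound g τ ≤ A/2^k propagates to every
    -- k and forces g τ ≤ 0.
    by_cases hex : ∃ k, g τ ≤ A * (1 / 2) ^ k ∧ η (k + 1) ≤ τ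
    · obtain ⟨k, hk, hk'⟩ := hex
      refine (hk.trans (le_of_eq ?_)).trans ((hfs τ).le_tsum k fun j _ => hf0 j τ)
      have : 1 ≤ max 0 τ / η (k + 1) := by
        rw [one_le_div (hη0 _)]; exact hk'.trans (le_max_right _ _)
      simp only [hf]
      rw [min_eq_left this, mul_one]
    · push Not at hex
      have hall : ∀ k, g τ ≤ A * (1 / 2) ^ k := by
        intro k
        induction k with
        | zero => rw [pow_zero, mul_one]; exact (hB τ hτ.le).trans (le_max_left _ _)
        | succ k ih => exact hη _ τ hτ.le (hex k ih)
      have hlim : Filter.Tendsto (fun k : ℕ => A * (1 / 2 : ℝ) ^ k) Filter.atTop (nhds 0) :=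
        hs.tendsto_atTop_zero
      exact (ge_of_tendsto' hlim hall).trans (tsum_nonneg (hf0 · τ))

theorem IsControl.diag {T : ℝ} {ω : ℝ → ℝ → ℝ} (hω : IsControl T ω) {s : ℝ} (hs : 0 ≤ s)
    (hsT : s ≤ T) : ω s s = 0 :=
  le_antisymm (by linarith [hω.superadd s s s hs le_rfl le_rfl hsT]) (hω.nonneg s s hs le_rfl hsT)

theorem IsControl.mono {T : ℝ} {ω : ℝ → ℝ → ℝ} (hω : IsControl T ω) {r s t u : ℝ} (hr : 0 ≤ r)
    (hrs : r ≤ s) (hst : s ≤ t) (htu : t ≤ u) (hu : u ≤ T) : ω s t ≤ ω r u := by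
  have h1 := hω.superadd r s t hr hrs hst (htu.trans hu)
  have h2 := hω.superadd r t u hr (hrs.trans hst) htu hu
  have h3 := hω.nonneg r s hr hrs ((hst.trans htu).trans hu)
  have h4 := hω.nonneg t u (hr.trans (hrs.trans hst)) htu hu
  linarith

/-! ### Davie's lemma and existence of D-solutions -/

section Sewing

variable {V : Type*} [NormedAddCommGroup V] {T : ℝ} {ω : ℝ → ℝ → ℝ}

/-- The numerical scheme `y_{k+1} = φ_{t_{k+1}, t_k}(y_k)`. -/
def scheme (φ : ℝ → ℝ → V → V) (t : ℕ → ℝ) (a : V) : ℕ → V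
  | 0 => a
  | k + 1 => φ (t (k + 1)) (t k) (scheme φ t a k)

/-- Move l to the right while the left block carries at most half of ω; at the last such l,
super-additivity leaves at most half to the right of t (l + 1). -/
theorem IsControl.exists_split (hω : IsControl T ω) {t : ℕ → ℝ} (ht : Monotone t)
    (htT : ∀ k, t k ∈ Set.Icc 0 T) {j k : ℕ} (hjk : j < k) :
    ∃ l, j ≤ l ∧ l < k ∧ ω (t j) (t l) ≤ ω (t j) (t k) / 2 ∧
      ω (t (l + 1)) (t k) ≤ ω (t j) (t k) / 2 := by
  have hpos : 0 ≤ ω (t j) (t k) := hω.nonneg _ _ (htT j).1 (ht hjk.le) (htT k).2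
  by_contra! hcon
  have hall : ∀ l, j ≤ l → l ≤ k → ω (t j) (t l) ≤ ω (t j) (t k) / 2 := by
    intro l hl
    induction l, hl using Nat.le_induction with
    | base => intro _; rw [hω.diag (htT j).1 (htT j).2]; positivity
    | succ l hl ih =>
      intro hlk
      have h1 := hcon l hl (by omega) (ih (by omega))
      have h2 := hω.superadd (t j) (t (l + 1)) (t k) (htT j).1 (ht (by omega)) (ht hlk) (htT k).2
      linarith
  have h1 := hall k hjk.le le_rfl
  have h2 := hcon (k - 1) (by omega) (by omega) (hall (k - 1) (by omega) (by omega))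
  rw [Nat.sub_add_cancel (by omega), hω.diag (htT k).1 (htT k).2] at h2
  linarith

variable {φ : ℝ → ℝ → V → V} {κ M : ℝ}

/-- Split the defect on [t j, t k] into the defects on the two blocks, the left one transported by φ
(t k) (t l), and two almost-flow errors, at t (l + 1) and at t l. -/
theorem scheme_split_bound (hκ : 0 ≤ κ) (hM : 0 ≤ M) (hω : IsControl T ω)
    (halmost : ∀ r s t, 0 ≤ r → r ≤ s → s ≤ t → t ≤ T →
      ∀ a, ‖φ t s (φ s r a) - φ t r a‖ ≤ M * ω r t ^ κ)
    {t : ℕ → ℝ} (ht : Monotone t) (htT : ∀ k, t k ∈ Set.Icc 0 T) {Λ : ℝ} (a : V) {j l k : ℕ}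
    (hlip : ∀ a b, ‖φ (t k) (t l) a - φ (t k) (t l) b‖ ≤ Λ * ‖a - b‖)
    (hjl : j ≤ l) (hlk : l < k) :
    ‖scheme φ t a k - φ (t k) (t j) (scheme φ t a j)‖ ≤
      ‖scheme φ t a k - φ (t k) (t (l + 1)) (scheme φ t a (l + 1))‖ +
      Λ * ‖scheme φ t a l - φ (t l) (t j) (scheme φ t a j)‖ + 2 * M * ω (t j) (t k) ^ κ := by
  have h1 := halmost (t l) (t (l + 1)) (t k) (htT l).1 (ht (by omega)) (ht hlk) (htT k).2
    (scheme φ t a l)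
  have h2 := halmost (t j) (t l) (t k) (htT j).1 (ht hjl) (ht hlk.le) (htT k).2
    (scheme φ t a j)
  have h3 := hlip (scheme φ t a l) (φ (t l) (t j) (scheme φ t a j))
  have h4 : M * ω (t l) (t k) ^ κ ≤ M * ω (t j) (t k) ^ κ := by
    refine mul_le_mul_of_nonneg_left (Real.rpow_le_rpow ?_ ?_ hκ) hM
    · exact hω.nonneg _ _ (htT l).1 (ht hlk.le) (htT k).2
    · exact hω.mono (htT j).1 (ht hjl) (ht hlk.le) le_rfl (htT k).2
  have key : scheme φ t a k - φ (t k) (t j) (scheme φ t a j) =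
      (scheme φ t a k - φ (t k) (t (l + 1)) (scheme φ t a (l + 1))) +
      (φ (t k) (t (l + 1)) (φ (t (l + 1)) (t l) (scheme φ t a l)) -
        φ (t k) (t l) (scheme φ t a l)) +
      (φ (t k) (t l) (scheme φ t a l) - φ (t k) (t l) (φ (t l) (t j) (scheme φ t a j))) +
      (φ (t k) (t l) (φ (t l) (t j) (scheme φ t a j)) - φ (t k) (t j) (scheme φ t a j)) := by
    simp only [scheme]; abel
  rw [key]
  refine (norm_add_le _ _).trans ?_
  refine (add_le_add_left (norm_add_le _ _) _).trans ?_
  refine (add_le_add_left (add_le_add_left (norm_add_le _ _) _) _).trans ?_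
  linarith

theorem half_rpow_bound {w w' κ C : ℝ} (hκ : 0 ≤ κ) (hC : 0 ≤ C) (hw' : 0 ≤ w') (h : w' ≤ w / 2) :
    C * w' ^ κ ≤ C * (w ^ κ / 2 ^ κ) := by
  have hw : 0 ≤ w := by linarith
  rw [← Real.div_rpow hw (by norm_num)]
  exact mul_le_mul_of_nonneg_left (Real.rpow_le_rpow hw' h hκ) hC

/-- **Davie's lemma**: the scheme associated with an almost flow stays close to it, uniformly in
the partition and in the initial point. -/
theorem exists_scheme_bound (hκ : 1 < κ) (hM : 0 ≤ M) (hω : IsControl T ω)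
    (hdiag : ∀ t, 0 ≤ t → t ≤ T → φ t t = id)
    (hlip : ∀ Λ > 1, ∃ ε > 0, ∀ s t, 0 ≤ s → s ≤ t → t ≤ T → ω s t ≤ ε →
      ∀ a b, ‖φ t s a - φ t s b‖ ≤ Λ * ‖a - b‖)
    (hlip' : ∃ Λ ≥ 0, ∀ s t, 0 ≤ s → s ≤ t → t ≤ T →
      ∀ a b, ‖φ t s a - φ t s b‖ ≤ Λ * ‖a - b‖)
    (halmost : ∀ r s t, 0 ≤ r → r ≤ s → s ≤ t → t ≤ T →
      ∀ a, ‖φ t s (φ s r a) - φ t r a‖ ≤ M * ω r t ^ κ) :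
    ∃ C ≥ 0, ∀ t : ℕ → ℝ, Monotone t → (∀ k, t k ∈ Set.Icc 0 T) → ∀ a, ∀ j k, j ≤ k →
      ‖scheme φ t a k - φ (t k) (t j) (scheme φ t a j)‖ ≤ C * ω (t j) (t k) ^ κ := by
  have hκ0 : 0 ≤ κ := by linarith
  have h2κ : (2 : ℝ) < 2 ^ κ := by
    simpa using Real.rpow_lt_rpow_of_exponent_lt (x := 2) (by norm_num) hκ
  -- Since κ > 1, halving ω gains a factor 2^κ > 2, which leaves room for a Lipschitz constant
  -- slightly above 1.
  obtain ⟨Λ, hΛ1, hΛ2⟩ : ∃ Λ : ℝ, 1 < Λ ∧ 1 + Λ < 2 ^ κ :=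
    ⟨2 ^ κ / 2, by linarith, by linarith⟩
  obtain ⟨ε, hε, hlipε⟩ := hlip Λ hΛ1
  have small : ∃ C ≥ 0, ∀ t : ℕ → ℝ, Monotone t → (∀ k, t k ∈ Set.Icc 0 T) → ∀ a, ∀ j k, j ≤ k →
      ω (t j) (t k) ≤ ε →
      ‖scheme φ t a k - φ (t k) (t j) (scheme φ t a j)‖ ≤ C * ω (t j) (t k) ^ κ := by
    -- The constant C = 2M/q is the fixed point of C ↦ C (1 + Λ)/2^κ + 2M, so the strong induction
    -- closes without loss.
    set q : ℝ := 1 - (1 + Λ) / 2 ^ κ with hq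
    have hq0 : 0 < q := by
      rw [hq, sub_pos, div_lt_one (by positivity)]; exact hΛ2
    have hC : 0 ≤ 2 * M / q := by positivity
    refine ⟨2 * M / q, hC, fun t ht htT a j k hjk => ?_⟩
    obtain ⟨d, rfl⟩ := Nat.exists_eq_add_of_le hjk
    clear hjk
    induction d using Nat.strong_induction_on generalizing j with
    | _ d ih =>
      intro hle
      have hω0 := hω.nonneg _ _ (htT j).1 (ht (by omega : j ≤ j + d)) (htT _).2
      rcases Nat.eq_zero_or_pos d with rfl | hd
      · rw [add_zero, hdiag _ (htT j).1 (htT j).2, id, sub_self, norm_zero,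
          hω.diag (htT j).1 (htT j).2]
        positivity
      · obtain ⟨l, hjl, hlk, hw1, hw2⟩ := hω.exists_split ht htT (by omega : j < j + d)
        have hs := scheme_split_bound hκ0 hM hω halmost ht htT a
          (hlipε (t l) (t (j + d)) (htT l).1 (ht hlk.le) (htT _).2
            ((hω.mono (htT j).1 (ht hjl) (ht hlk.le) le_rfl (htT _).2).trans hle)) hjl hlk
        have e1 : l + 1 + (j + d - (l + 1)) = j + d := by omega
        have e2 : j + (l - j) = l := by omega
        have i1 := ih (j + d - (l + 1)) (by omega) (l + 1)
        rw [e1] at i1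
        have i2 := ih (l - j) (by omega) j
        rw [e2] at i2
        have j1 := (i1 (by linarith)).trans (half_rpow_bound hκ0 hC
          (hω.nonneg _ _ (htT _).1 (ht hlk) (htT _).2) hw2)
        have j2 := (i2 (by linarith)).trans (half_rpow_bound hκ0 hC
          (hω.nonneg _ _ (htT _).1 (ht hjl) (htT _).2) hw1)
        have j3 := mul_le_mul_of_nonneg_left j2 (by linarith : 0 ≤ Λ)
        refine (hs.trans (add_le_add_left (add_le_add j1 j3) _)).trans (le_of_eq ?_)
        have h2 : (1 + Λ) / 2 ^ κ = 1 - q := by rw [hq]; ring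
        have h3 : 2 * M / q * (1 - q) + 2 * M = 2 * M / q := by field_simp; ring
        calc _ = (2 * M / q * ((1 + Λ) / 2 ^ κ) + 2 * M) * ω (t j) (t (j + d)) ^ κ := by ring
          _ = _ := by rw [h2, h3]
  obtain ⟨Λ', hΛ', hlipΛ⟩ := hlip'
  -- Finitely many doublings reach ω 0 T, so here the constant may grow at each step and any uniform
  -- Lipschitz bound suffices.
  have scale : ∀ m : ℕ, ∃ C ≥ 0, ∀ t : ℕ → ℝ, Monotone t → (∀ k, t k ∈ Set.Icc 0 T) → ∀ a,
      ∀ j k, j ≤ k → ω (t j) (t k) ≤ ε * 2 ^ m →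
      ‖scheme φ t a k - φ (t k) (t j) (scheme φ t a j)‖ ≤ C * ω (t j) (t k) ^ κ := by
    intro m
    induction m with
    | zero => simpa using small
    | succ m ih =>
      obtain ⟨C, hC, hb⟩ := ih
      refine ⟨(1 + Λ') * C + 2 * M, by positivity, fun t ht htT a j k hjk hle => ?_⟩
      have hω0 := hω.nonneg _ _ (htT j).1 (ht hjk) (htT k).2
      rcases hjk.eq_or_lt with rfl | hjk
      · rw [hdiag _ (htT j).1 (htT j).2, id, sub_self, norm_zero]
        positivity
      · obtain ⟨l, hjl, hlk, hw1, hw2⟩ := hω.exists_split ht htT hjk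
        have hs := scheme_split_bound hκ0 hM hω halmost ht htT a
          (hlipΛ (t l) (t k) (htT l).1 (ht hlk.le) (htT _).2) hjl hlk
        have hhalf : ω (t j) (t k) / 2 ≤ ε * 2 ^ m := by rw [pow_succ] at hle; linarith
        have j1 := hb t ht htT a (l + 1) k hlk (hw2.trans hhalf)
        have j2 := hb t ht htT a j l hjl (hw1.trans hhalf)
        have k1 := mul_le_mul_of_nonneg_left (Real.rpow_le_rpow
          (hω.nonneg _ _ (htT _).1 (ht hlk) (htT _).2) (hw2.trans (half_le_self hω0)) hκ0) hC
        have k2 := mul_le_mul_of_nonneg_left (Real.rpow_le_rpow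
          (hω.nonneg _ _ (htT _).1 (ht hjl) (htT _).2) (hw1.trans (half_le_self hω0)) hκ0) hC
        have j3 := mul_le_mul_of_nonneg_left (j2.trans k2) hΛ'
        refine (hs.trans (add_le_add_left (add_le_add (j1.trans k1) j3) _)).trans (le_of_eq ?_)
        ring
  obtain ⟨m, hm⟩ := pow_unbounded_of_one_lt (ω 0 T / ε) (by norm_num : (1 : ℝ) < 2)
  obtain ⟨C, hC, hb⟩ := scale m
  refine ⟨C, hC, fun t ht htT a j k hjk => hb t ht htT a j k hjk ?_⟩
  have h1 := hω.mono le_rfl (htT j).1 (ht hjk) (htT k).2 le_rfl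
  rw [div_lt_iff₀ hε] at hm
  linarith

theorem exists_monotone_seq_of_finset (hT : 0 ≤ T) (π : Finset ℝ) :
    ∃ t : ℕ → ℝ, Monotone t ∧ (∀ k, t k ∈ Set.Icc 0 T) ∧ t 0 = 0 ∧
      ∀ u ∈ π, u ∈ Set.Icc 0 T → ∃ k, t k = u := by
  classical
  set σ : Finset ℝ := insert 0 (π.filter (· ∈ Set.Icc 0 T)) with hσ
  have hσT : ∀ u ∈ σ, u ∈ Set.Icc 0 T := by
    intro u hu
    rw [hσ, Finset.mem_insert, Finset.mem_filter] at hu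
    rcases hu with rfl | hu
    · exact ⟨le_rfl, hT⟩
    · exact hu.2
  have h0 : (0 : ℝ) ∈ σ := Finset.mem_insert_self _ _
  have hc : 0 < σ.card := Finset.card_pos.2 ⟨0, h0⟩
  refine ⟨fun k => σ.orderEmbOfFin rfl ⟨min k (σ.card - 1), by omega⟩, ?_, ?_, ?_, ?_⟩
  · intro j k hjk
    refine (σ.orderEmbOfFin rfl).monotone ?_
    simp only [Fin.mk_le_mk]
    omega
  · exact fun k => hσT _ (Finset.orderEmbOfFin_mem _ _ _)
  · simp only [zero_min]
    rw [Finset.orderEmbOfFin_zero rfl hc]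
    refine le_antisymm (Finset.min'_le _ _ h0) (Finset.le_min' _ _ _ fun u hu => (hσT u hu).1)
  · intro u hu huT
    have hmem : u ∈ Set.range (σ.orderEmbOfFin rfl) := by
      rw [Finset.range_orderEmbOfFin]
      exact Finset.mem_insert_of_mem (Finset.mem_filter.2 ⟨hu, huT⟩)
    obtain ⟨i, hi⟩ := hmem
    refine ⟨i, ?_⟩
    rw [← hi]
    exact congrArg _ (Fin.ext (min_eq_left (by omega)))

/-- On a finite set of times, the scheme satisfies the defining estimate of D-solutions. -/
theorem exists_discrete_solution (hT : 0 ≤ T) (hω : IsControl T ω)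
    (hdiag : ∀ t, 0 ≤ t → t ≤ T → φ t t = id) {C : ℝ} (hC : 0 ≤ C)
    (hb : ∀ t : ℕ → ℝ, Monotone t → (∀ k, t k ∈ Set.Icc 0 T) → ∀ a, ∀ j k, j ≤ k →
      ‖scheme φ t a k - φ (t k) (t j) (scheme φ t a j)‖ ≤ C * ω (t j) (t k) ^ κ)
    (a : V) (π : Finset ℝ) :
    ∃ y : ℝ → V, y 0 = a ∧ ∀ s ∈ π, ∀ t ∈ π, 0 ≤ s → s ≤ t → t ≤ T →
      ‖y t - φ t s (y s)‖ ≤ C * ω s t ^ κ := by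
  obtain ⟨t, ht, htT, ht0, hcov⟩ := exists_monotone_seq_of_finset hT π
  -- Index 0 is imposed at u = 0 to have y 0 = a, whether or not 0 belongs to π.
  have hidx : ∀ u, ∃ k, (u = 0 → k = 0) ∧ (u ∈ π → u ∈ Set.Icc 0 T → t k = u) := by
    intro u
    by_cases hu0 : u = 0
    · exact ⟨0, fun _ => rfl, fun _ _ => ht0.trans hu0.symm⟩
    · by_cases hu : u ∈ π ∧ u ∈ Set.Icc 0 T
      · obtain ⟨k, hk⟩ := hcov u hu.1 hu.2
        exact ⟨k, fun h => absurd h hu0, fun _ _ => hk⟩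
      · exact ⟨0, fun h => absurd h hu0, fun h1 h2 => absurd ⟨h1, h2⟩ hu⟩
  choose κ' hk0 hk using hidx
  refine ⟨fun u => scheme φ t a (κ' u), by simp only [hk0 0 rfl, scheme], ?_⟩
  intro s hs u hu hs0 hsu huT
  have es := hk s hs ⟨hs0, hsu.trans huT⟩
  have eu := hk u hu ⟨hs0.trans hsu, huT⟩
  rcases hsu.eq_or_lt with rfl | hlt
  · rw [hdiag s hs0 huT, id, sub_self, norm_zero]
    have := hω.nonneg s s hs0 le_rfl huT
    positivity
  · have hle : κ' s ≤ κ' u := by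
      by_contra hcon
      have := ht (le_of_not_ge hcon)
      rw [es, eu] at this
      exact absurd this (not_le.2 hlt)
    have := hb t ht htT a _ _ hle
    rwa [es, eu] at this

/-- Pointwise limits suffice: the D-estimate passes to them because φ is continuous in space, and it
then forces continuity in time. -/
theorem exists_isDSolution [ProperSpace V] (hκ : 1 < κ) (hM : 0 ≤ M) (hT : 0 ≤ T)
    (hω : IsControl T ω)
    (hdiag : ∀ t, 0 ≤ t → t ≤ T → φ t t = id)
    (hnear : ∀ ρ > 0, ∃ ε > 0, ∀ s t, 0 ≤ s → s ≤ t → t ≤ T → ω s t ≤ ε →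
      ∀ a, ‖φ t s a - a‖ ≤ ρ)
    (hlip : ∀ Λ > 1, ∃ ε > 0, ∀ s t, 0 ≤ s → s ≤ t → t ≤ T → ω s t ≤ ε →
      ∀ a b, ‖φ t s a - φ t s b‖ ≤ Λ * ‖a - b‖)
    (hlip' : ∃ Λ ≥ 0, ∀ s t, 0 ≤ s → s ≤ t → t ≤ T →
      ∀ a b, ‖φ t s a - φ t s b‖ ≤ Λ * ‖a - b‖)
    (halmost : ∀ r s t, 0 ≤ r → r ≤ s → s ≤ t → t ≤ T →
      ∀ a, ‖φ t s (φ s r a) - φ t r a‖ ≤ M * ω r t ^ κ) :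
    ∃ C ≥ 0, ∀ a, ∃ y : ℝ → V, IsDSolution T ω φ κ C a y := by
  have hκ0 : 0 < κ := by linarith
  obtain ⟨C, hC, hb⟩ := exists_scheme_bound hκ hM hω hdiag hlip hlip' halmost
  refine ⟨C, hC, fun a => ?_⟩
  choose Y hY0 hY using exists_discrete_solution hT hω hdiag hC hb a
  -- Every given time eventually belongs to π along this ultrafilter, and values confined to a
  -- compact ball converge along it, so no subsequences are needed.
  set 𝒰 : Ultrafilter (Finset ℝ) := Ultrafilter.of Filter.atTop
  have hmem : ∀ u : ℝ, ∀ᶠ π : Finset ℝ in (𝒰 : Filter (Finset ℝ)), u ∈ π := fun u =>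
    Ultrafilter.of_le _ ((Filter.eventually_ge_atTop {u}).mono fun π hπ =>
      hπ (Finset.mem_singleton_self u))
  have hconv : ∀ u, ∃ v, 0 ≤ u → u ≤ T →
      Filter.Tendsto (fun π => Y π u) (𝒰 : Filter (Finset ℝ)) (nhds v) := by
    intro u
    by_cases hu : 0 ≤ u ∧ u ≤ T
    · have hball : ∀ᶠ π in (𝒰 : Filter (Finset ℝ)),
          Y π u ∈ Metric.closedBall (φ u 0 a) (C * ω 0 u ^ κ) := by
        filter_upwards [hmem 0, hmem u] with π h0 hu'
        rw [mem_closedBall_iff_norm]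
        have := hY π 0 h0 u hu' le_rfl hu.1 hu.2
        rwa [hY0] at this
      obtain ⟨v, _, hv⟩ := (isCompact_closedBall (φ u 0 a) (C * ω 0 u ^ κ)).ultrafilter_le_nhds
        (𝒰.map fun π => Y π u) (Filter.le_principal_iff.2 hball)
      exact ⟨v, fun _ _ => hv⟩
    · exact ⟨0, fun h1 h2 => absurd ⟨h1, h2⟩ hu⟩
  choose y hy using hconv
  have hbound : ∀ s t, 0 ≤ s → s ≤ t → t ≤ T → ‖y t - φ t s (y s)‖ ≤ C * ω s t ^ κ := by
    intro s t hs hst ht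
    obtain ⟨Λ, hΛ, hΛlip⟩ := hlip'
    have hcont : Continuous (φ t s) := by
      refine (LipschitzWith.of_dist_le_mul (K := ⟨Λ, hΛ⟩) fun b c => ?_).continuous
      rw [dist_eq_norm, dist_eq_norm]
      exact hΛlip s t hs hst ht b c
    have h1 := hy t (hs.trans hst) ht
    have h2 := (hcont.tendsto _).comp (hy s hs (hst.trans ht))
    refine le_of_tendsto (h1.sub h2).norm ?_
    filter_upwards [hmem s, hmem t] with π hs' ht'
    exact hY π s hs' t ht' hs hst ht
  refine ⟨y, ?_, ?_, hbound⟩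
  · have hsmall : ∀ ρ > 0, ∃ η > 0, ∀ s t, 0 ≤ s → s ≤ t → t ≤ T → t - s < η →
        ‖y t - y s‖ < ρ := by
      intro ρ hρ
      obtain ⟨ε, hε, hn⟩ := hnear (ρ / 3) (by positivity)
      have hlim : Filter.Tendsto (fun w : ℝ => C * w ^ κ) (nhds 0) (nhds 0) := by
        have h := ((Real.continuousAt_rpow_const 0 κ (Or.inr hκ0.le)).tendsto).const_mul C
        rwa [Real.zero_rpow hκ0.ne', mul_zero] at h
      obtain ⟨ε', hε', hn'⟩ := Metric.eventually_nhds_iff.1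
        (hlim.eventually (gt_mem_nhds (show 0 < ρ / 3 by positivity)))
      obtain ⟨η, hη, hω'⟩ := hω.small (min ε ε') (lt_min hε hε')
      refine ⟨η, hη, fun s t hs hst ht hlt => ?_⟩
      have hw := hω' s t hs hst ht hlt
      have hw0 := hω.nonneg s t hs hst ht
      have h1 := hn s t hs hst ht (hw.le.trans (min_le_left _ _)) (y s)
      have h2 : C * ω s t ^ κ < ρ / 3 := hn' (by
        rw [Real.dist_eq, sub_zero, abs_of_nonneg hw0]; exact hw.trans_le (min_le_right _ _))
      have h3 := hbound s t hs hst ht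
      have h4 := norm_add_le (y t - φ t s (y s)) (φ t s (y s) - y s)
      rw [sub_add_sub_cancel] at h4
      linarith
    rw [Metric.continuousOn_iff]
    intro t ht ρ hρ
    obtain ⟨η, hη, h⟩ := hsmall ρ hρ
    refine ⟨η, hη, fun s hs hst => ?_⟩
    rw [Real.dist_eq, abs_lt] at hst
    rw [dist_eq_norm]
    rcases le_total s t with hle | hle
    · rw [norm_sub_rev]; exact h s t hs.1 hle ht.2 (by linarith)
    · exact h t s ht.1 hle hs.2 (by linarith)
  · have h := hy 0 le_rfl hT
    simp only [hY0] at h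
    exact tendsto_nhds_unique tendsto_const_nhds h |>.symm

end Sewing

/-! ### Taylor expansion along the flow of a Newtonian map -/

namespace IsNewtonianMap

open NormGrading

variable {W V : Type*} [NormedRing W] [NormedAlgebra ℝ W] [NormedAddCommGroup V] [NormedSpace ℝ V]
  {G : NormGrading W} {n : ℕ} {L : Submodule ℝ W} {F : W →ₗ[ℝ] (V → V)} {ν : ℕ → ℝ}

/-- With no component of degree 0, each term carries at least one factor h; the remaining powers are
absorbed by H. -/
theorem bound_of_gradedBound (hν0 : ∀ i, 0 ≤ ν i)
    (hν : ∀ i, 1 ≤ i → i ≤ n → ∀ α ∈ G.piece i,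
      (∀ a, ‖F α a‖ ≤ ν i * ‖α‖) ∧ ∀ a b, ‖F α a - F α b‖ ≤ ν i * ‖α‖ * ‖a - b‖)
    {H h c : ℝ} (hh : 0 ≤ h) (hH : h ≤ H) (hc : 0 ≤ c) {α : W} (hα : α ∈ G.le n)
    (hα0 : G.comp 0 α = 0) (hb : G.GradedBound n h c α) :
    (∀ a, ‖F α a‖ ≤ (∑ i ∈ Finset.range n, ν (i + 1) * c * H ^ i) * h) ∧
    ∀ a b, ‖F α a - F α b‖ ≤ (∑ i ∈ Finset.range n, ν (i + 1) * c * H ^ i) * h * ‖a - b‖ := by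
  have hsum : α = ∑ i ∈ Finset.range n, G.comp (i + 1) α := by
    conv_lhs => rw [G.eq_sum_comp hα, Finset.sum_range_succ', hα0, add_zero]
  have hF : ∀ a, F α a = ∑ i ∈ Finset.range n, F (G.comp (i + 1) α) a := by
    intro a
    conv_lhs => rw [hsum, map_sum, Finset.sum_apply]
  have hterm : ∀ i < n, ν (i + 1) * ‖G.comp (i + 1) α‖ ≤ ν (i + 1) * c * H ^ i * h := by
    intro i hi
    have h1 := hb (i + 1) (by omega)
    have h2 : c * h ^ (i + 1) ≤ c * (H ^ i * h) := by
      rw [pow_succ]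
      gcongr
    have := mul_le_mul_of_nonneg_left (h1.trans h2) (hν0 (i + 1))
    linarith
  constructor
  · intro a
    rw [hF, Finset.sum_mul]
    refine norm_sum_le_of_le _ fun i hi => ?_
    rw [Finset.mem_range] at hi
    exact ((hν (i + 1) (by omega) (by omega) _ (G.comp_mem _ α)).1 a).trans (hterm i hi)
  · intro a b
    rw [hF, hF, ← Finset.sum_sub_distrib, Finset.sum_mul, Finset.sum_mul]
    refine norm_sum_le_of_le _ fun i hi => ?_
    rw [Finset.mem_range] at hi
    exact ((hν (i + 1) (by omega) (by omega) _ (G.comp_mem _ α)).2 a b).trans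
      (mul_le_mul_of_nonneg_right (hterm i hi) (norm_nonneg _))

/-- The Newtonian relation for inhomogeneous elements, up to the terms of degree `> n`. -/
theorem norm_fderiv_sub_le (hF : IsNewtonianMap G n L F) (hν0 : ∀ i, 0 ≤ ν i)
    (hν : ∀ i, 1 ≤ i → i ≤ n → ∀ α ∈ G.piece i,
      (∀ a, ‖F α a‖ ≤ ν i * ‖α‖) ∧ ∀ a b, ‖F α a - F α b‖ ≤ ν i * ‖α‖ * ‖a - b‖)
    {H h c d : ℝ} (hh : 0 ≤ h) (hH : h ≤ H) (hc : 0 ≤ c) (hd : 0 ≤ d) {α β : W}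
    (hα : α ∈ G.le n) (hαL : ∀ i ≤ n, G.comp i α ∈ L)
    (hβ : β ∈ G.le n) (hbα : G.GradedBound n h c α) (hbβ : G.GradedBound n h d β) (y : V) :
    ‖fderiv ℝ (F β) y (F α y) - F (G.tmul n α β) y‖ ≤
      (∑ i ∈ Finset.range (n + 1), ∑ j ∈ Finset.range (n + 1),
        ν i * ν j * H ^ (i + j - (n + 1))) * (c * h ^ (n + 1)) * d := by
  have hH0 : 0 ≤ H := hh.trans hH
  set D : ℕ → ℕ → V := fun i j => fderiv ℝ (F (G.comp j β)) y (F (G.comp i α) y) with hD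
  have h1 : fderiv ℝ (F β) y (F α y) =
      ∑ i ∈ Finset.range (n + 1), ∑ j ∈ Finset.range (n + 1), D i j := by
    have hFα : F α y = ∑ i ∈ Finset.range (n + 1), F (G.comp i α) y := by
      conv_lhs => rw [G.eq_sum_comp hα, map_sum, Finset.sum_apply]
    have hFβ : fderiv ℝ (F β) y = ∑ j ∈ Finset.range (n + 1), fderiv ℝ (F (G.comp j β)) y := by
      conv_lhs => rw [G.eq_sum_comp hβ, map_sum]
      refine fderiv_sum fun j hj => ?_
      rw [Finset.mem_range] at hj
      exact ((hF.contDiff _ (G.comp_mem_le (by omega) β)).differentiable one_ne_zero) y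
    rw [hFα, map_sum, hFβ]
    exact Finset.sum_congr rfl fun i _ => by rw [sum_apply]
  have h2 : F (G.tmul n α β) y =
      ∑ i ∈ Finset.range (n + 1), ∑ j ∈ Finset.range (n + 1 - i), D i j := by
    simp only [tmul, map_sum, Finset.sum_apply]
    refine Finset.sum_congr rfl fun i hi => Finset.sum_congr rfl fun j hj => ?_
    rw [Finset.mem_range] at hi hj
    refine hF.map_mul _ ⟨hαL i (by omega), G.comp_mem_le (by omega) α⟩ _
      (G.comp_mem_le (by omega) β) ?_ y
    exact G.mem_le_of_mem_piece (by omega) (G.mul_mem i j _ (G.comp_mem i α) _ (G.comp_mem j β))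
  rw [h1, h2, ← Finset.sum_sub_distrib, Finset.sum_mul, Finset.sum_mul]
  refine norm_sum_le_of_le _ fun i hi => ?_
  rw [Finset.mem_range] at hi
  have hsub : Finset.range (n + 1 - i) ⊆ Finset.range (n + 1) :=
    Finset.range_subset_range.2 (by omega)
  rw [← Finset.sum_sdiff_eq_sub hsub, Finset.sum_mul, Finset.sum_mul]
  refine (norm_sum_le_of_le _ fun j hj => ?_).trans
    (Finset.sum_le_sum_of_subset_of_nonneg Finset.sdiff_subset fun j _ _ => ?_)
  · rw [Finset.mem_sdiff, Finset.mem_range, Finset.mem_range] at hj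
    -- In the leftover terms i + j > n with i, j ≤ n, so both degrees are at least 1 and the
    -- unbounded F[1] = id never appears.
    have b1 := (hν i (by omega) (by omega) _ (G.comp_mem i α)).1 y
    have hK : 0 ≤ ν j * ‖G.comp j β‖ := mul_nonneg (hν0 j) (norm_nonneg _)
    have b2 : ‖fderiv ℝ (F (G.comp j β)) y‖ ≤ ν j * ‖G.comp j β‖ := by
      refine norm_fderiv_le_of_lipschitz ℝ (C := ⟨ν j * ‖G.comp j β‖, hK⟩)
        (LipschitzWith.of_dist_le_mul fun a b => ?_)
      rw [dist_eq_norm, dist_eq_norm]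
      exact (hν j (by omega) (by omega) _ (G.comp_mem j β)).2 a b
    have b3 : ‖D i j‖ ≤ (ν j * ‖G.comp j β‖) * (ν i * ‖G.comp i α‖) :=
      (ContinuousLinearMap.le_opNorm _ _).trans (mul_le_mul b2 b1 (norm_nonneg _) hK)
    have b4 : (ν j * ‖G.comp j β‖) * (ν i * ‖G.comp i α‖) ≤
        (ν j * (d * h ^ j)) * (ν i * (c * h ^ i)) := by
      have := hν0 i
      have := hν0 j
      have := hbα i (by omega)
      have := hbβ j (by omega)
      gcongr
    have b5 : h ^ j * h ^ i ≤ H ^ (i + j - (n + 1)) * h ^ (n + 1) := by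
      have e : h ^ j * h ^ i = h ^ (i + j - (n + 1)) * h ^ (n + 1) := by
        rw [← pow_add, ← pow_add]; congr 1; omega
      rw [e]
      gcongr
    have b6 : (ν i * ν j * (c * d)) * (h ^ j * h ^ i) ≤
        (ν i * ν j * (c * d)) * (H ^ (i + j - (n + 1)) * h ^ (n + 1)) :=
      mul_le_mul_of_nonneg_left b5
        (mul_nonneg (mul_nonneg (hν0 i) (hν0 j)) (mul_nonneg hc hd))
    refine (b3.trans b4).trans ((le_of_eq ?_).trans (b6.trans (le_of_eq ?_))) <;> ring
  · have := hν0 i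
    have := hν0 j
    positivity

/-- Taylor expansion of `F[β]` along a solution of `z' = F[α](z)`. -/
theorem taylor (hF : IsNewtonianMap G n L F) {h c R : ℝ} (hh : 0 ≤ h) (hc : 0 ≤ c) {α : W}
    (hα0 : G.comp 0 α = 0) (hbα : G.GradedBound n h c α)
    (hR : ∀ β ∈ G.le n, ∀ d ≥ 0, G.GradedBound n h d β → ∀ y,
      ‖fderiv ℝ (F β) y (F α y) - F (G.tmul n α β) y‖ ≤ R * d)
    {a : V} {z : ℝ → V} (hz0 : z 0 = a)
    (hz : ∀ u ∈ Set.Icc (0 : ℝ) 1, HasDerivWithinAt z (F α (z u)) (Set.Icc 0 1) u)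
    (m : ℕ) : ∀ β ∈ G.le n, (∀ j, j + m < n + 1 → G.comp j β = 0) → ∀ d ≥ 0,
      G.GradedBound n h d β → ∀ u ∈ Set.Icc (0 : ℝ) 1,
      ‖F β (z u) - F (∑ k ∈ Finset.range (n + 1),
        (u ^ k / (k.factorial : ℝ)) • (G.tmul n α)^[k] β) a‖ ≤
        R * d * ∑ k ∈ Finset.range m, (((n : ℝ) + 1) * c) ^ k := by
  -- Test `hR` on the unit, with a size made strictly positive by the added 1 even if W is trivial.
  have hR0 : 0 ≤ R := by
    have := hR 1 (G.one_mem_le n) (‖(1 : W)‖ + 1) (by positivity) (fun i hi =>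
      (gradedBound_one n hh i hi).trans (mul_le_mul_of_nonneg_right (by linarith)
        (by positivity))) a
    exact nonneg_of_mul_nonneg_left ((norm_nonneg _).trans this) (by positivity)
  induction m with
  | zero =>
    intro β hβ hβ0 d _ _ u _
    have : β = 0 := G.eq_of_comp_eq hβ (Submodule.zero_mem _) fun j hj => by
      rw [map_zero]; exact hβ0 j (by omega)
    subst this
    have hit : ∀ k, (G.tmul n α)^[k] (0 : W) = 0 := fun k =>
      Function.iterate_fixed (by simp [tmul]) k
    simp [hit]
  | succ m ih =>
    intro β hβ hβ0 d hd hb u hu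
    set T : W → W := G.tmul n α
    -- Nilpotency lets the sum keep the range k ≤ n after differentiation in u: the shifted top term
    -- vanishes.
    have hTn : T^[n + 1] β = 0 :=
      G.eq_of_comp_eq (G.iterate_tmul_mem_le α hβ _) (Submodule.zero_mem _) fun j hj => by
        rw [G.comp_iterate_tmul _ _ _ j hj, map_zero]
        exact G.comp_mul_eq_zero (b := 0) (G.comp_pow_eq_zero hα0 (n + 1))
          (fun _ h => by omega) j (by omega)
    have hb' : G.GradedBound n h ((n + 1) * c * d) (T β) :=
      (hbα.mul hh hc hd hb).congr fun j hj => G.comp_tmul hj α β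
    have hT0 : ∀ j, j + m < n + 1 → G.comp j (T β) = 0 := by
      intro j hj
      rw [G.comp_tmul (by omega)]
      exact G.comp_mul_eq_zero (a := 1) (b := n - m) (fun i hi => by rwa [Nat.lt_one_iff.1 hi])
        (fun i hi => hβ0 i (by omega)) j (by omega)
    -- The derivative of the remainder for β is the Newtonian defect plus the remainder for T β,
    -- whose lowest degree is one higher.
    have hstep := ih (T β) (G.tmul_mem_le n α β) hT0 _ (by positivity) hb'
    have hP : ∀ u : ℝ, ∀ γ, F (∑ k ∈ Finset.range (n + 1),
        (u ^ k / (k.factorial : ℝ)) • T^[k] γ) a =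
        ∑ k ∈ Finset.range (n + 1), (u ^ k / (k.factorial : ℝ)) • F (T^[k] γ) a := by
      intro u γ
      simp only [map_sum, map_smul, Finset.sum_apply, Pi.smul_apply]
    have hder : ∀ u ∈ Set.Icc (0 : ℝ) 1, HasDerivWithinAt
        (fun u => F β (z u) - F (∑ k ∈ Finset.range (n + 1),
          (u ^ k / (k.factorial : ℝ)) • T^[k] β) a)
        (fderiv ℝ (F β) (z u) (F α (z u)) - F (∑ k ∈ Finset.range (n + 1),
          (u ^ k / (k.factorial : ℝ)) • T^[k] (T β)) a) (Set.Icc 0 1) u := by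
      intro u hu
      have h1 : HasFDerivAt (F β) (fderiv ℝ (F β) (z u)) (z u) :=
        ((hF.contDiff β hβ).differentiable one_ne_zero _).hasFDerivAt
      refine (h1.comp_hasDerivWithinAt u (hz u hu)).sub ?_
      simp only [hP]
      have h2 : ∀ k ∈ Finset.range (n + 1), HasDerivAt
          (fun u : ℝ => (u ^ k / (k.factorial : ℝ)) • F (T^[k] β) a)
          ((k * u ^ (k - 1) / (k.factorial : ℝ)) • F (T^[k] β) a) u := fun k _ =>
        ((hasDerivAt_pow k u).div_const _).smul_const _
      have h3 := HasDerivAt.fun_sum h2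
      convert h3.hasDerivWithinAt using 1
      rw [Finset.sum_range_succ, Finset.sum_range_succ', ← Function.iterate_succ_apply, hTn]
      simp only [map_zero, Pi.zero_apply, smul_zero, Nat.cast_zero, zero_mul, zero_div, zero_smul,
        add_zero]
      refine Finset.sum_congr rfl fun k _ => ?_
      rw [Function.iterate_succ_apply, Nat.add_sub_cancel, Nat.factorial_succ]
      congr 1
      push_cast
      field_simp
    have hbound : ∀ u ∈ Set.Ico (0 : ℝ) 1,
        ‖fderiv ℝ (F β) (z u) (F α (z u)) - F (∑ k ∈ Finset.range (n + 1),
          (u ^ k / (k.factorial : ℝ)) • T^[k] (T β)) a‖ ≤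
        R * d * ∑ k ∈ Finset.range (m + 1), (((n : ℝ) + 1) * c) ^ k := by
      intro u hu
      have h1 := hR β hβ d hd hb (z u)
      have h2 := hstep u ⟨hu.1, hu.2.le⟩
      refine (norm_sub_le_norm_sub_add_norm_sub _ (F (T β) (z u)) _).trans
        ((add_le_add h1 h2).trans (le_of_eq ?_))
      rw [geom_sum_succ]
      ring
    have hfin := norm_image_sub_le_of_norm_deriv_le_segment' hder hbound u hu
    have hz0' : F β (z 0) - F (∑ k ∈ Finset.range (n + 1),
        ((0 : ℝ) ^ k / (k.factorial : ℝ)) • T^[k] β) a = 0 := by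
      rw [hP, Finset.sum_range_succ', hz0]
      simp
    rw [hz0', sub_zero, sub_zero] at hfin
    exact hfin.trans (mul_le_of_le_one_right (by positivity) hu.2)

/-- Expansion of `F[β]` along the flow of `F[log_▷ x]`. -/
theorem norm_sub_tmul_le [CompleteSpace V] (hF : IsNewtonianMap G n L F) (hn : 0 < n)
    (hν0 : ∀ i, 0 ≤ ν i)
    (hν : ∀ i, 1 ≤ i → i ≤ n → ∀ α ∈ G.piece i,
      (∀ a, ‖F α a‖ ≤ ν i * ‖α‖) ∧ ∀ a b, ‖F α a - F α b‖ ≤ ν i * ‖α‖ * ‖a - b‖)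
    (hL : ∀ i, i ≤ n → ∀ α ∈ L, G.comp i α ∈ L) (H : ℝ) {c : ℝ} (hc : 0 ≤ c) :
    ∃ C ≥ 0, ∀ h, 0 ≤ h → h ≤ H → ∀ x, G.comp 0 x = 1 → G.tlog n x ∈ L ⊓ G.le n →
      G.GradedBound n h c (G.tlog n x) → ∀ β ∈ G.le n, ∀ d ≥ 0, G.GradedBound n h d β →
      ∀ a z, IsODESolution (F (G.tlog n x)) a z →
      ‖F β (z 1) - F (G.tmul n x β) a‖ ≤ C * h ^ (n + 1) * d := by
  rcases lt_or_ge H 0 with hH0 | hH0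
  · exact ⟨0, le_rfl, fun h h0 hH => absurd (h0.trans hH) (not_le.2 hH0)⟩
  set K : ℝ := ∑ i ∈ Finset.range (n + 1), ∑ j ∈ Finset.range (n + 1),
    ν i * ν j * H ^ (i + j - (n + 1)) with hK
  have hK0 : 0 ≤ K := Finset.sum_nonneg fun i _ => Finset.sum_nonneg fun j _ =>
    mul_nonneg (mul_nonneg (hν0 i) (hν0 j)) (pow_nonneg hH0 _)
  refine ⟨K * c * ∑ k ∈ Finset.range (n + 1), (((n : ℝ) + 1) * c) ^ k, by positivity, ?_⟩
  intro h hh hH x hx hlog hb β hβ d hd hbβ a z hz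
  have hcont : Continuous (F (G.tlog n x)) :=
    hF.continuous _ (G.le_mono (Nat.le_succ n) hlog.2)
  have ht := hF.taylor hh hc (comp_zero_tlog hx) hb (R := K * (c * h ^ (n + 1)))
    (fun γ hγ e he hbγ y => hF.norm_fderiv_sub_le hν0 hν hh hH hc he hlog.2
      (fun i hi => hL i hi _ hlog.1) hγ hb hbγ y) hz.initial
    -- With m = n + 1 the vanishing condition on β is vacuous.
    (fun u hu => (hz.hasDerivWithinAt hcont hu.1).mono Set.Icc_subset_Ici_self) (n + 1) β hβ
    (fun j hj => by omega) d hd hbβ 1 ⟨zero_le_one, le_rfl⟩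
  simp only [one_pow] at ht
  rw [G.sum_iterate_tmul_tlog hn hx hβ] at ht
  exact ht.trans (le_of_eq (by ring))

end IsNewtonianMap

/-! ### From Hölder-type bounds to almost flows and D-solutions -/

theorem exists_forall_mul_rpow_le {K q : ℝ} (hq : 0 < q) {ρ : ℝ} (hρ : 0 < ρ) :
    ∃ ε > 0, ∀ w : ℝ, 0 ≤ w → w ≤ ε → K * w ^ q ≤ ρ := by
  have hlim : Filter.Tendsto (fun w : ℝ => K * w ^ q) (nhds 0) (nhds 0) := by
    have h := ((Real.continuousAt_rpow_const 0 q (Or.inr hq.le)).tendsto).const_mul K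
    rwa [Real.zero_rpow hq.ne', mul_zero] at h
  obtain ⟨ε, hε, h⟩ := Metric.eventually_nhds_iff.1 (hlim.eventually (gt_mem_nhds hρ))
  refine ⟨ε / 2, by positivity, fun w hw hwε => (h ?_).le⟩
  rw [Real.dist_eq, sub_zero, abs_of_nonneg hw]
  linarith

/-- A family of maps with Hölder-type bounds relative to the control is an almost flow. -/
theorem isAlmostFlow_of_bounds {V : Type*} [NormedAddCommGroup V] {T : ℝ} (hT : 0 ≤ T)
    {ω : ℝ → ℝ → ℝ} (hω : IsControl T ω) {φ : ℝ → ℝ → V → V} {K q κ M : ℝ} (hK : 0 ≤ K)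
    (hq : 0 < q) (hκ : 1 < κ) (hM : 0 ≤ M)
    (hdiag : ∀ t, 0 ≤ t → t ≤ T → φ t t = id)
    (hnear : ∀ s t, 0 ≤ s → s ≤ t → t ≤ T → ∀ a, ‖φ t s a - a‖ ≤ K * ω s t ^ q)
    (hlip : ∀ s t, 0 ≤ s → s ≤ t → t ≤ T →
      ∀ a b, ‖φ t s a - φ t s b‖ ≤ Real.exp (K * ω s t ^ q) * ‖a - b‖)
    (halmost : ∀ r s t, 0 ≤ r → r ≤ s → s ≤ t → t ≤ T →
      ∀ a, ‖φ t s (φ s r a) - φ t r a‖ ≤ M * ω r t ^ κ) : IsAlmostFlow T ω φ := by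
  refine ⟨hdiag, ?_, κ, hκ, M, hM, halmost⟩
  -- This dominates both the displacement, by y ≤ exp y - 1, and the excess of the Lipschitz
  -- constant over 1; `min τ T` is there because ω is only controlled up to T.
  set g : ℝ → ℝ := fun τ => Real.exp (K * ω 0 (min τ T) ^ q) - 1 with hg
  have hmono : ∀ r s t u, 0 ≤ r → r ≤ s → s ≤ t → t ≤ u → u ≤ T →
      K * ω s t ^ q ≤ K * ω r u ^ q := fun r s t u hr hrs hst htu hu =>
    mul_le_mul_of_nonneg_left (Real.rpow_le_rpow
      (hω.nonneg s t (hr.trans hrs) hst (htu.trans hu)) (hω.mono hr hrs hst htu hu) hq.le) hK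
  obtain ⟨δ, hδm, hδc, hδ0, hgδ⟩ := exists_continuous_monotone_ge (g := g)
    (B := Real.exp (K * ω 0 T ^ q) - 1)
    (fun τ hτ => sub_le_sub_right (Real.exp_le_exp.2 (hmono 0 0 _ T le_rfl le_rfl
      (le_min hτ hT) (min_le_right _ _) le_rfl)) 1)
    (by simp [hg, min_eq_left hT, hω.diag le_rfl hT, Real.zero_rpow hq.ne'])
    (fun ε hε => by
      obtain ⟨w, hw, hwK⟩ := exists_forall_mul_rpow_le (K := K) hq
        (Real.log_pos (by linarith : 1 < 1 + ε))
      obtain ⟨η, hη, hωη⟩ := hω.small w hw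
      refine ⟨η, hη, fun τ hτ hτη => ?_⟩
      have h0 : 0 ≤ min τ T := le_min hτ hT
      have h1 := hωη 0 (min τ T) le_rfl h0 (min_le_right _ _)
        (by linarith [min_le_left τ T])
      have h2 := Real.exp_le_exp.2 (hwK _ (hω.nonneg _ _ le_rfl h0 (min_le_right _ _)) h1.le)
      rw [Real.exp_log (by linarith)] at h2
      simp only [hg]
      linarith)
  refine ⟨δ, hδm, hδc, hδ0, fun τ s t hs hst htτ hτT => ?_⟩
  have h1 := hmono 0 s t τ le_rfl hs hst htτ hτT
  have h2 := hgδ τ (hs.trans (hst.trans htτ))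
  simp only [hg, min_eq_left hτT] at h2
  have h3 := Real.add_one_le_exp (K * ω s t ^ q)
  have h4 := Real.exp_le_exp.2 h1
  refine ⟨fun a => (hnear s t hs hst (htτ.trans hτT) a).trans (by linarith), fun a b =>
    (hlip s t hs hst (htτ.trans hτT) a b).trans ?_⟩
  exact mul_le_mul_of_nonneg_right (by linarith) (norm_nonneg _)

theorem exists_isDSolution_of_bounds {V : Type*} [NormedAddCommGroup V] [ProperSpace V] {T : ℝ}
    (hT : 0 ≤ T) {ω : ℝ → ℝ → ℝ} (hω : IsControl T ω) {φ : ℝ → ℝ → V → V} {K q κ M : ℝ}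
    (hK : 0 ≤ K) (hq : 0 < q) (hκ : 1 < κ) (hM : 0 ≤ M)
    (hdiag : ∀ t, 0 ≤ t → t ≤ T → φ t t = id)
    (hnear : ∀ s t, 0 ≤ s → s ≤ t → t ≤ T → ∀ a, ‖φ t s a - a‖ ≤ K * ω s t ^ q)
    (hlip : ∀ s t, 0 ≤ s → s ≤ t → t ≤ T →
      ∀ a b, ‖φ t s a - φ t s b‖ ≤ Real.exp (K * ω s t ^ q) * ‖a - b‖)
    (halmost : ∀ r s t, 0 ≤ r → r ≤ s → s ≤ t → t ≤ T →
      ∀ a, ‖φ t s (φ s r a) - φ t r a‖ ≤ M * ω r t ^ κ) :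
    ∃ C ≥ 0, ∀ a, ∃ y : ℝ → V, IsDSolution T ω φ κ C a y := by
  refine exists_isDSolution hκ hM hT hω hdiag ?_ ?_ ?_ halmost
  · intro ρ hρ
    obtain ⟨ε, hε, h⟩ := exists_forall_mul_rpow_le (K := K) hq hρ
    exact ⟨ε, hε, fun s t hs hst ht hle a =>
      (hnear s t hs hst ht a).trans (h _ (hω.nonneg s t hs hst ht) hle)⟩
  · intro Λ hΛ
    obtain ⟨ε, hε, h⟩ := exists_forall_mul_rpow_le (K := K) hq (Real.log_pos hΛ)
    refine ⟨ε, hε, fun s t hs hst ht hle a b => (hlip s t hs hst ht a b).trans ?_⟩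
    refine mul_le_mul_of_nonneg_right ?_ (norm_nonneg _)
    rw [← Real.le_log_iff_exp_le (by linarith)]
    exact h _ (hω.nonneg s t hs hst ht) hle
  · refine ⟨Real.exp (K * ω 0 T ^ q), (Real.exp_pos _).le, fun s t hs hst ht a b =>
      (hlip s t hs hst ht a b).trans ?_⟩
    refine mul_le_mul_of_nonneg_right (Real.exp_le_exp.2 ?_) (norm_nonneg _)
    exact mul_le_mul_of_nonneg_left (Real.rpow_le_rpow (hω.nonneg s t hs hst ht)
      (hω.mono le_rfl hs hst ht le_rfl) hq.le) hK

/-! ### The log-flow of a rough path -/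

theorem IsRoughPath.exists_gradedBound {W : Type*} [NormedRing W] [NormedAlgebra ℝ W]
    {G : NormGrading W} {T p : ℝ} {ω : ℝ → ℝ → ℝ} {x : ℝ → ℝ → W} (hω : IsControl T ω)
    (hx : IsRoughPath G T p ω x) (n : ℕ) :
    ∃ c ≥ 0, ∀ s t, 0 ≤ s → s ≤ t → t ≤ T → G.GradedBound n (ω s t ^ (1 / p)) c (x s t - 1) := by
  obtain ⟨μ, hμ0, hμ⟩ := hx.bound
  refine ⟨∑ i ∈ Finset.range (n + 1), μ i, Finset.sum_nonneg fun i _ => hμ0 i, ?_⟩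
  intro s t hs hst ht i hi
  have h0 := hω.nonneg s t hs hst ht
  rw [map_sub]
  rcases Nat.eq_zero_or_pos i with rfl | hi0
  · rw [hx.comp_zero s t hs hst ht, G.comp_zero_one, sub_self, norm_zero]
    exact mul_nonneg (Finset.sum_nonneg fun i _ => hμ0 i) (by positivity)
  · rw [G.comp_one_of_ne hi0.ne', sub_zero, ← Real.rpow_natCast, ← Real.rpow_mul h0,
      one_div_mul_eq_div]
    refine (hμ i hi0 s t hs hst ht).trans (mul_le_mul_of_nonneg_right ?_ (by positivity))
    exact Finset.single_le_sum (fun i _ => hμ0 i) (Finset.mem_range.2 (by omega))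

theorem mainTheorem3 {W V : Type*} [NormedRing W] [NormedAlgebra ℝ W] [Nontrivial W]
    [NormedAddCommGroup V] [NormedSpace ℝ V] [CompleteSpace V]
    (G : NormGrading W) (T : ℝ) (hT : 0 ≤ T) (ω : ℝ → ℝ → ℝ) (hω : IsControl T ω)
    (p : ℝ) (hp : 1 ≤ p) (n : ℕ) (hn : 0 < n) (hpn : ⌊p⌋₊ ≤ n)
    (L : Submodule ℝ W) (hL : ∀ i, i ≤ n → ∀ α ∈ L, G.comp i α ∈ L)
    (x : ℝ → ℝ → W) (hx : IsRoughPath G T p ω x)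
    (hlog : ∀ s t, 0 ≤ s → s ≤ t → t ≤ T → G.tlog n (x s t) ∈ L ⊓ G.le n)
    (F : W →ₗ[ℝ] (V → V)) (hF : IsNewtonianMap G n L F)
    (ν : ℕ → ℝ) (hν0 : ∀ i, 0 ≤ ν i)
    (hν : ∀ i, 1 ≤ i → i ≤ n → ∀ α ∈ G.piece i,
      (∀ a, ‖F α a‖ ≤ ν i * ‖α‖) ∧ ∀ a b, ‖F α a - F α b‖ ≤ ν i * ‖α‖ * ‖a - b‖) :
    (∀ s t, 0 ≤ s → s ≤ t → t ≤ T → ∀ a,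
      (∃ z, IsODESolution (F (G.tlog n (x s t))) a z) ∧
      ∀ z, IsODESolution (F (G.tlog n (x s t))) a z → logFlow G n F x t s a = z 1) ∧
    IsAlmostFlow T ω (logFlow G n F x) ∧
    (FiniteDimensional ℝ V → ∃ C ≥ 0, ∀ a, ∃ y : ℝ → V,
      IsDSolution T ω (logFlow G n F x) (((n : ℝ) + 1) / p) C a y) := by
  have hp0 : 0 < p := by linarith
  have hq : 0 < 1 / p := by positivity
  have hκ : 1 < ((n : ℝ) + 1) / p := by
    rw [one_lt_div hp0]
    exact (Nat.lt_floor_add_one p).trans_le (by exact_mod_cast Nat.succ_le_succ hpn)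
  have hpow : ∀ w : ℝ, 0 ≤ w → (w ^ (1 / p)) ^ (n + 1) = w ^ (((n : ℝ) + 1) / p) := by
    intro w hw
    rw [← Real.rpow_natCast, ← Real.rpow_mul hw, one_div_mul_eq_div]
    push_cast
    rfl
  have hmono : ∀ r s t u, 0 ≤ r → r ≤ s → s ≤ t → t ≤ u → u ≤ T →
      ω s t ^ (1 / p) ≤ ω r u ^ (1 / p) := fun r s t u hr hrs hst htu hu =>
    Real.rpow_le_rpow (hω.nonneg s t (hr.trans hrs) hst (htu.trans hu))
      (hω.mono hr hrs hst htu hu) hq.le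
  obtain ⟨c, hc, hxb⟩ := hx.exists_gradedBound hω n
  obtain ⟨c', hc', hlogb⟩ := G.exists_gradedBound_tlog n hc
  set H : ℝ := ω 0 T ^ (1 / p) with hH
  set K : ℝ := ∑ i ∈ Finset.range n, ν (i + 1) * c' * H ^ i with hK
  have hω0 : ∀ s t, 0 ≤ s → s ≤ t → t ≤ T → 0 ≤ ω s t ^ (1 / p) := fun s t hs hst ht =>
    Real.rpow_nonneg (hω.nonneg s t hs hst ht) _
  have hK0 : 0 ≤ K := Finset.sum_nonneg fun i _ =>
    mul_nonneg (mul_nonneg (hν0 _) hc') (pow_nonneg (hω0 0 T le_rfl hT le_rfl) _)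
  have hbound : ∀ s t, 0 ≤ s → s ≤ t → t ≤ T →
      (∀ a, ‖F (G.tlog n (x s t)) a‖ ≤ K * ω s t ^ (1 / p)) ∧
      ∀ a b, ‖F (G.tlog n (x s t)) a - F (G.tlog n (x s t)) b‖ ≤
        K * ω s t ^ (1 / p) * ‖a - b‖ := fun s t hs hst ht =>
    IsNewtonianMap.bound_of_gradedBound hν0 hν (hω0 s t hs hst ht)
      (hmono 0 s t T le_rfl hs hst ht le_rfl) hc' (hlog s t hs hst ht).2
      (NormGrading.comp_zero_tlog (hx.comp_zero s t hs hst ht))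
      (hlogb _ (hω0 s t hs hst ht) _ (hxb s t hs hst ht))
  have hLip : ∀ s t (hs : 0 ≤ s) (hst : s ≤ t) (ht : t ≤ T),
      LipschitzWith ⟨K * ω s t ^ (1 / p), mul_nonneg hK0 (hω0 s t hs hst ht)⟩
        (F (G.tlog n (x s t))) := fun s t hs hst ht => LipschitzWith.of_dist_le_mul fun a b => by
    rw [dist_eq_norm, dist_eq_norm]
    exact (hbound s t hs hst ht).2 a b
  have hex : ∀ s t, 0 ≤ s → s ≤ t → t ≤ T → ∀ a,
      ∃ z, IsODESolution (F (G.tlog n (x s t))) a z := fun s t hs hst ht a =>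
    exists_isODESolution (hLip s t hs hst ht) (hbound s t hs hst ht).1 a
  have huniq : ∀ s t, 0 ≤ s → s ≤ t → t ≤ T → ∀ a z,
      IsODESolution (F (G.tlog n (x s t))) a z → logFlow G n F x t s a = z 1 :=
    fun s t hs hst ht a z hz => timeOneMap_eq (hLip s t hs hst ht) hz
  have hnear : ∀ s t, 0 ≤ s → s ≤ t → t ≤ T → ∀ a,
      ‖logFlow G n F x t s a - a‖ ≤ K * ω s t ^ (1 / p) := by
    intro s t hs hst ht a
    obtain ⟨z, hz⟩ := hex s t hs hst ht a
    rw [huniq s t hs hst ht a z hz]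
    exact hz.norm_sub_le (hbound s t hs hst ht).1 zero_le_one le_rfl
  have hlip : ∀ s t, 0 ≤ s → s ≤ t → t ≤ T → ∀ a b,
      ‖logFlow G n F x t s a - logFlow G n F x t s b‖ ≤
        Real.exp (K * ω s t ^ (1 / p)) * ‖a - b‖ := by
    intro s t hs hst ht a b
    obtain ⟨y, hy⟩ := hex s t hs hst ht a
    obtain ⟨z, hz⟩ := hex s t hs hst ht b
    rw [huniq s t hs hst ht a y hy, huniq s t hs hst ht b z hz]
    have := hy.dist_le (hLip s t hs hst ht) hz zero_le_one
    rwa [mul_one, dist_eq_norm, dist_eq_norm, mul_comm] at this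
  have hdiag : ∀ t, 0 ≤ t → t ≤ T → logFlow G n F x t t = id := by
    intro t ht htT
    funext a
    have h := hnear t t ht le_rfl htT a
    rw [hω.diag ht htT, Real.zero_rpow hq.ne', mul_zero] at h
    exact sub_eq_zero.1 (norm_le_zero_iff.1 h)
  obtain ⟨C, hC, hexp⟩ := hF.norm_sub_tmul_le hn hν0 hν hL H hc'
  -- The scale h may exceed ω s t ^ (1 / p), so that the expansions on [r, s], [s, t] and [r, t]
  -- share h = ω r t ^ (1 / p).
  have hflow : ∀ s t, 0 ≤ s → s ≤ t → t ≤ T → ∀ h, ω s t ^ (1 / p) ≤ h → h ≤ H →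
      ∀ β ∈ G.le n, ∀ d ≥ 0, G.GradedBound n h d β → ∀ a,
      ‖F β (logFlow G n F x t s a) - F (G.tmul n (x s t) β) a‖ ≤ C * h ^ (n + 1) * d := by
    intro s t hs hst ht h hh hhH β hβ d hd hb a
    obtain ⟨z, hz⟩ := hex s t hs hst ht a
    rw [huniq s t hs hst ht a z hz]
    have h0 := hω0 s t hs hst ht
    exact hexp h (h0.trans hh) hhH _ (hx.comp_zero s t hs hst ht) (hlog s t hs hst ht)
      ((hlogb _ h0 _ (hxb s t hs hst ht)).mono hc' h0 hh) β hβ d hd hb a z hz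
  have halmost : ∀ r s t, 0 ≤ r → r ≤ s → s ≤ t → t ≤ T → ∀ a,
      ‖logFlow G n F x t s (logFlow G n F x s r a) - logFlow G n F x t r a‖ ≤
        C * (2 * ‖(1 : W)‖ + (c + ‖(1 : W)‖)) * ω r t ^ (((n : ℝ) + 1) / p) := by
    intro r s t hr hrs hst ht a
    have hs := hr.trans hrs
    have hrt := hrs.trans hst
    set h : ℝ := ω r t ^ (1 / p) with hh
    have h0 : 0 ≤ h := hω0 r t hr hrt ht
    have hhH : h ≤ H := hmono 0 r t T le_rfl hr hrt ht le_rfl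
    have hone := NormGrading.gradedBound_one (G := G) n h0
    have hst_le : ω s t ^ (1 / p) ≤ h := hmono r s t t hr hrs hst le_rfl ht
    -- The product with 1 truncates x s t, bringing it into `G.le n`, where the expansion applies.
    have hX : G.GradedBound n h (c + ‖(1 : W)‖) (G.tmul n (x s t) 1) := by
      intro i hi
      rw [G.comp_tmul hi, mul_one, ← sub_add_cancel (x s t) 1, map_add, add_mul]
      exact (norm_add_le _ _).trans (add_le_add
        (((hxb s t hs hst ht).mono hc (hω0 s t hs hst ht) hst_le) i hi) (hone i hi))
    have e1 := hflow s t hs hst ht h hst_le hhH 1 (G.one_mem_le n) _ (norm_nonneg _) hone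
      (logFlow G n F x s r a)
    have e2 := hflow r s hr hrs (hst.trans ht) h (hmono r r s t hr le_rfl hrs hst ht) hhH _
      (G.tmul_mem_le n _ _) _ (by positivity) hX a
    have e3 := hflow r t hr hrt ht h le_rfl hhH 1 (G.one_mem_le n) _ (norm_nonneg _) hone a
    -- Chen's relation survives truncation, so `e2` ends at the point from which `e3` starts and the
    -- three errors telescope.
    have hchen : G.tmul n (x r s) (G.tmul n (x s t) 1) = G.tmul n (x r t) 1 := by
      refine G.eq_of_comp_eq (G.tmul_mem_le n _ _) (G.tmul_mem_le n _ _) fun j hj => ?_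
      rw [G.comp_tmul hj, G.comp_tmul hj, ← hx.mul r s t hr hrs hst ht, mul_assoc]
      exact G.comp_mul_congr (fun _ _ => rfl) (fun i hi => G.comp_tmul hi _ _) j hj
    rw [hF.map_one, id] at e1 e3
    rw [hchen] at e2
    rw [norm_sub_rev] at e3
    have hsum := (norm_add₃_le (a := logFlow G n F x t s (logFlow G n F x s r a) -
      F (G.tmul n (x s t) 1) (logFlow G n F x s r a))).trans (add_le_add (add_le_add e1 e2) e3)
    rw [sub_add_sub_cancel, sub_add_sub_cancel] at hsum
    rw [← hpow _ (hω.nonneg r t hr hrt ht), ← hh]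
    exact hsum.trans (le_of_eq (by ring))
  have hM : 0 ≤ C * (2 * ‖(1 : W)‖ + (c + ‖(1 : W)‖)) := by positivity
  refine ⟨fun s t hs hst ht a => ⟨hex s t hs hst ht a, huniq s t hs hst ht a⟩,
    isAlmostFlow_of_bounds hT hω hK0 hq hκ hM hdiag hnear hlip halmost, fun hfin => ?_⟩
  have : ProperSpace V := FiniteDimensional.proper_real V
  exact exists_isDSolution_of_bounds hT hω hK0 hq hκ hM hdiag hnear hlip halmost
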